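/- Fix $m\in(0,1]$, $p\ge 1$, $\beta\ge 1$, and a compact convex set $K\subset\mathbb R^d$. For a probability measure $\mu$ on $\mathbb R^d$, let $$d_\mu(x)=\Big(\frac1m\int_0^m\delta_{\mu,u}(x)^p\,du\Big)^{1/p},\qquad \delta_{\mu,u}(x)=\inf\{r>0:\mu(B(x,r))>u\},$$ where $B(x,r)$ is the open ball. For a closed set $F\subset\mathbb R^d$, let $\Gamma_F(x,y)$ be the set of rectifiable (absolutely continuous) paths $\gamma:[0,1]\to\mathbb R^d$ from $x$ to $y$ such that for every open interval $I\subset[0,1]$ with $\gamma(I)\subset\mathbb R^d\setminus F$ there is a unit vector $u$ with $\dot\gamma(t)=\|\dot\gamma(t)\|u$ for almost all $t\in I$. Write $|\gamma|=\int_0^1\|\dot\gamma(t)\|\,dt$ and let $$D_\mu(\gamma)=\int_0^1 d_\mu(\gamma(t))^\beta\|\dot\gamma(t)\|\,dt,\qquad D_{\mu,F}(x,y)=\inf_{\gamma\in\Gamma_F(x,y)}D_\mu(\gamma).$$ A path $\gamma\in\Gamma_F(x,y)$ with $D_\mu(\gamma)=D_{\mu,F}(x,y)$ is called a geodesic. Let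 $W_p$ be the Wasserstein distance of order $p$ for the Euclidean norm. Finally, set $$\lambda=2c\,\frac{\rho^{\beta+1}}{\rho-1},\qquad \rho=1+\frac{32}{m},\qquad c=\frac{16\cdot5^\beta+1152\cdot165^\beta}{m^{2+\beta}},$$ which depends only on $m$ and $\beta$. **Theorem (FDTM stability with respect to the measure).** Let $\mu,\nu$ be probability measures on $\mathbb R^d$ with supports contained in $K$, and let $F\subset K$ be closed. Then $\lambda$ bounds the Euclidean length of geodesics: for all $x,y\in K$ and every geodesic $\gamma\in\Gamma_F(x,y)$ for $\mu$ and $F$, $$|\gamma|\le\lambda\,\sup_{t\in[0,1]}d_\mu(\gamma(t)).$$ Moreover, $$\sup_{x,y\in K}\big|D_{\mu,F}(x,y)-D_{\nu,F}(x,y)\big|\;\le\;\lambda\,\mathrm{diam}(K)\,\sup_{x\in K}\big|d_\mu(x)^\beta-d_\nu(x)^\beta\big|\;\le\;\frac{\beta\lambda}{m^{1/p}}\,\mathrm{diam}(K)^\beta\,W_p(\mu,\nu).$$ -/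

import Mathlib

open MeasureTheory Set
open scoped ENNReal

namespace FermatDTM

noncomputable section

/-- The pseudo distance-to-measure: the infimum of the radii `r > 0` of the open balls centred at
`x` whose `μ`-mass exceeds `u`. -/
def pseudoDTM {d : ℕ} (μ : Measure (EuclideanSpace ℝ (Fin d))) (u : ℝ)
    (x : EuclideanSpace ℝ (Fin d)) : ℝ :=
  sInf {r : ℝ | 0 < r ∧ ENNReal.ofReal u < μ (Metric.ball x r)}

/-- The distance-to-measure with mass parameter `m` and exponent `p`: the `p`-mean of
`pseudoDTM μ u x` over `u ∈ [0, m]`. -/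
def dtm {d : ℕ} (m p : ℝ) (μ : Measure (EuclideanSpace ℝ (Fin d)))
    (x : EuclideanSpace ℝ (Fin d)) : ℝ :=
  ((1 / m) * ∫ u in (0 : ℝ)..m, pseudoDTM μ u x ^ p) ^ (1 / p)

/-- Rectifiable paths parameterized by `[0, 1]` (absolutely continuous, so that the speed
`‖deriv γ‖` exists almost everywhere, is integrable, and integrates to the Euclidean length)
that go from `x` to `y` and may leave `F` only along straight lines: on every open interval
that `γ` maps outside `F`, its derivative has a constant direction. -/
structure IsAdmissible {d : ℕ} (F : Set (EuclideanSpace ℝ (Fin d)))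
    (x y : EuclideanSpace ℝ (Fin d)) (γ : ℝ → EuclideanSpace ℝ (Fin d)) : Prop where
  rectifiable : AbsolutelyContinuousOnInterval γ 0 1
  source : γ 0 = x
  target : γ 1 = y
  straight : ∀ a b : ℝ, Ioo a b ⊆ Icc 0 1 → MapsTo γ (Ioo a b) Fᶜ →
    ∃ u : EuclideanSpace ℝ (Fin d), ‖u‖ = 1 ∧
      ∀ᵐ t : ℝ, t ∈ Ioo a b → deriv γ t = ‖deriv γ t‖ • u

/-- The Euclidean length `∫₀¹ ‖γ'(t)‖ dt` of a path. -/
def pathLength {d : ℕ} (γ : ℝ → EuclideanSpace ℝ (Fin d)) : ℝ≥0∞ :=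
  ∫⁻ t in Icc (0 : ℝ) 1, ‖deriv γ t‖ₑ

/-- The FDTM length `∫₀¹ d_μ(γ(t))^β ‖γ'(t)‖ dt` of a path. -/
def fdtmLength {d : ℕ} (m p β : ℝ) (μ : Measure (EuclideanSpace ℝ (Fin d)))
    (γ : ℝ → EuclideanSpace ℝ (Fin d)) : ℝ :=
  ∫ t in (0 : ℝ)..1, dtm m p μ (γ t) ^ β * ‖deriv γ t‖

/-- The Fermat distance-to-measure `D_{μ,F}(x, y)`: the infimum of the FDTM lengths of the
admissible paths from `x` to `y`. -/
def fdtm {d : ℕ} (m p β : ℝ) (μ : Measure (EuclideanSpace ℝ (Fin d)))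
    (F : Set (EuclideanSpace ℝ (Fin d))) (x y : EuclideanSpace ℝ (Fin d)) : ℝ :=
  sInf (fdtmLength m p β μ '' {γ | IsAdmissible F x y γ})

/-- Minimizing geodesics: admissible paths whose FDTM length is the FDTM of their endpoints. -/
def IsGeodesic {d : ℕ} (m p β : ℝ) (μ : Measure (EuclideanSpace ℝ (Fin d)))
    (F : Set (EuclideanSpace ℝ (Fin d))) (x y : EuclideanSpace ℝ (Fin d))
    (γ : ℝ → EuclideanSpace ℝ (Fin d)) : Prop :=
  IsAdmissible F x y γ ∧ fdtmLength m p β μ γ = fdtm m p β μ F x y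

/-- The supremum norm of `f` over `s`, as an extended nonnegative real. -/
def supNormOn {α : Type*} (s : Set α) (f : α → ℝ) : ℝ≥0∞ :=
  ⨆ x ∈ s, ‖f x‖ₑ

/-- The Wasserstein distance of order `p`, as an extended nonnegative real: the infimum runs over
the probability measures `π` on the product with marginals `μ` and `ν`. -/
def wasserstein {d : ℕ} (p : ℝ) (μ ν : Measure (EuclideanSpace ℝ (Fin d))) : ℝ≥0∞ :=
  ⨅ π ∈ {π : Measure (EuclideanSpace ℝ (Fin d) × EuclideanSpace ℝ (Fin d)) |
      IsProbabilityMeasure π ∧ π.fst = μ ∧ π.snd = ν},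
    (∫⁻ z, ‖z.1 - z.2‖ₑ ^ p ∂π) ^ (1 / p)

/-- The ratio `ρ = 1 + 32 / m`. -/
def geodesicRho (m : ℝ) : ℝ := 1 + 32 / m

/-- The constant `c = (16 · 5^β + 1152 · 165^β) / m^(2 + β)`. -/
def geodesicC (m β : ℝ) : ℝ :=
  (16 * (5 : ℝ) ^ β + 1152 * (165 : ℝ) ^ β) / m ^ (2 + β)

/-- The constant `λ = 2 c ρ^(β + 1) / (ρ - 1)` of the geodesic length bound. -/
def geodesicConst (m β : ℝ) : ℝ :=
  2 * geodesicC m β * (geodesicRho m ^ (β + 1) / (geodesicRho m - 1))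

end

end FermatDTM

/-! The proof rests on one property of f = d_μ, `IsCoverable`: f is nonnegative, 1-Lipschitz, and
each set {f ≤ r} is covered by at most N = 2/m balls of radius 5r. Indeed f(z) ≤ r forces the balls
around z of radius above 2r to have mass at least m/2, so a 5r-separated subset of {f ≤ r} has at
most 2/m points.

Length bound. The anchor times (γ in F, or an end of the path) cut a path into straight flights. The
piece between two anchor times may be replaced by its chord, so along a minimizer it costs no more
than the chord. A flight along which f ≤ r has length at most 10Nr; taking chords in each of the N
covering balls bounds the total weighted length of these flights by a multiple of r^(β+1)
(`weightedLength_levelTimes_le`). If moreover f exceeds r/2 somewhere on the flight, then f is at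
least of order r/N on at least half of its length, because a straight line spends little length in
few small balls; hence its length is at most a multiple of r^(-β) times its weighted length
(`IsFlight.lintegral_le`). The product is linear in r, and summing over r = R/2^k gives a multiple
of R (`lintegral_deriv_le_of_minimizing`). The times where f = 0 contribute no length, since f has
finitely many zeros.

Stability of the distance. Existence of geodesics is not needed. Flooring the weight at some δ > 0
leaves finitely many scales, so good almost minimizers obey the same length bound up to a factor 2,
for which λ has room (`exists_almost_minimizing`). Such a path for μ, measured with d_ν, costs at
most its length times sup |d_μ^β - d_ν^β| more; exchanging μ and ν gives the first inequality.

Wasserstein bound. The integral of δ_{μ,u}(x)^p over u is the least cost of transporting to x a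
submeasure of μ of mass m (`pseudoDTMIntegral_le`, `exists_density`). Restricting a coupling to an
optimal submeasure and applying Minkowski gives m^(1/p) |d_μ - d_ν| ≤ W_p, and also, with the
diagonal coupling, the Lipschitz property. The mean value inequality for t^β on [0, diam K]
concludes. -/

namespace FermatDTM

/-! ### Absolutely continuous paths in Euclidean space -/

section AbsolutelyContinuous

variable {X Y : Type*} [PseudoMetricSpace X] [PseudoMetricSpace Y]

/-- If the increments of `g` are controlled by those of `f`, absolute continuity passes from `f`
to `g`. -/
theorem ac_of_dist_le {f : ℝ → X} {g : ℝ → Y} {a b C : ℝ} (hC : 0 ≤ C)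
    (hf : AbsolutelyContinuousOnInterval f a b)
    (h : ∀ s ∈ uIcc a b, ∀ t ∈ uIcc a b, dist (g s) (g t) ≤ C * dist (f s) (f t)) :
    AbsolutelyContinuousOnInterval g a b := by
  rw [absolutelyContinuousOnInterval_iff] at hf ⊢
  intro ε hε
  obtain ⟨δ, hδ, H⟩ := hf (ε / (C + 1)) (by positivity)
  refine ⟨δ, hδ, fun E hE hs => ?_⟩
  have h1 := H E hE hs
  calc ∑ i ∈ Finset.range E.1, dist (g (E.2 i).1) (g (E.2 i).2)
      ≤ ∑ i ∈ Finset.range E.1, C * dist (f (E.2 i).1) (f (E.2 i).2) :=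
        Finset.sum_le_sum fun i hi => h _ (hE.1 i hi).1 _ (hE.1 i hi).2
    _ = C * ∑ i ∈ Finset.range E.1, dist (f (E.2 i).1) (f (E.2 i).2) := by rw [Finset.mul_sum]
    _ ≤ C * (ε / (C + 1)) := by gcongr
    _ < (C + 1) * (ε / (C + 1)) := by gcongr; linarith
    _ = ε := by field_simp

theorem ac_congr {f g : ℝ → X} {a b : ℝ} (hf : AbsolutelyContinuousOnInterval f a b)
    (h : EqOn f g (uIcc a b)) : AbsolutelyContinuousOnInterval g a b :=
  ac_of_dist_le zero_le_one hf fun s hs t ht => by rw [← h hs, ← h ht, one_mul]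

variable {d : ℕ} {γ : ℝ → EuclideanSpace ℝ (Fin d)} {a b c : ℝ}

theorem ac_apply (hγ : AbsolutelyContinuousOnInterval γ a b) (i : Fin d) :
    AbsolutelyContinuousOnInterval (fun t => γ t i) a b :=
  ac_of_dist_le zero_le_one hγ fun s _ t _ => by
    rw [one_mul, dist_eq_norm, dist_eq_norm]
    simpa using PiLp.norm_apply_le (γ s - γ t) i

/-- The path is the finite sum of its coordinates times basis vectors, and each embedding
`EuclideanSpace.single i` is isometric. -/
theorem ac_of_apply (h : ∀ i, AbsolutelyContinuousOnInterval (fun t => γ t i) a b) :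
    AbsolutelyContinuousOnInterval γ a b := by
  have key : ∀ s : Finset (Fin d), AbsolutelyContinuousOnInterval
      (fun t => ∑ i ∈ s, EuclideanSpace.single i (γ t i)) a b := by
    intro s
    induction s using Finset.induction_on with
    | empty =>
      exact (LipschitzWith.const (0 : EuclideanSpace ℝ (Fin d))).lipschitzOnWith
        |>.absolutelyContinuousOnInterval
    | insert i s hi ih =>
      simp_rw [Finset.sum_insert hi]
      refine AbsolutelyContinuousOnInterval.fun_add ?_ ih
      exact ac_of_dist_le zero_le_one (h i) fun s _ t _ => by
        rw [one_mul]; exact (PiLp.dist_single_same _ _ i _ _).le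
  refine ac_congr (key Finset.univ) fun t _ => ?_
  ext j
  simp [Finset.sum_apply, Pi.single_apply]

theorem ac_ae_differentiableAt (hγ : AbsolutelyContinuousOnInterval γ a b) :
    ∀ᵐ t : ℝ, t ∈ uIcc a b → DifferentiableAt ℝ γ t :=
  hγ.boundedVariationOn.ae_differentiableAt_of_mem_uIcc

theorem deriv_euclidean_apply {t : ℝ} (h : DifferentiableAt ℝ γ t) (i : Fin d) :
    deriv (fun t => γ t i) t = deriv γ t i :=
  ((EuclideanSpace.proj i : EuclideanSpace ℝ (Fin d) →L[ℝ] ℝ).hasFDerivAt.comp_hasDerivAt t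
    h.hasDerivAt).deriv

theorem euclidean_norm_le_sum (v : EuclideanSpace ℝ (Fin d)) : ‖v‖ ≤ ∑ i, ‖v i‖ := by
  have h : v = ∑ i, EuclideanSpace.single i (v i) := by
    ext j; simp [Finset.sum_apply, Pi.single_apply]
  calc ‖v‖ = ‖∑ i, EuclideanSpace.single i (v i)‖ := by rw [← h]
    _ ≤ ∑ i, ‖EuclideanSpace.single i (v i)‖ := norm_sum_le _ _
    _ = ∑ i, ‖v i‖ := by simp

theorem ac_intervalIntegrable_deriv (hγ : AbsolutelyContinuousOnInterval γ a b) :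
    IntervalIntegrable (deriv γ) volume a b := by
  rw [intervalIntegrable_iff]
  have h1 : ∀ i : Fin d, IntegrableOn (fun t => ‖deriv (fun t => γ t i) t‖) (uIoc a b) := fun i =>
    (intervalIntegrable_iff.1 (ac_apply hγ i).intervalIntegrable_deriv).norm
  refine Integrable.mono' (integrable_finsetSum Finset.univ fun i _ => h1 i)
    (aestronglyMeasurable_deriv _ _) ?_
  rw [ae_restrict_iff' measurableSet_uIoc]
  filter_upwards [ac_ae_differentiableAt hγ] with t ht htm
  have hd := ht (uIoc_subset_uIcc htm)
  refine (euclidean_norm_le_sum _).trans_eq ?_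
  simp_rw [deriv_euclidean_apply hd]

theorem ac_integral_deriv (hγ : AbsolutelyContinuousOnInterval γ a b) :
    ∫ t in a..b, deriv γ t = γ b - γ a := by
  ext i
  have h1 := (EuclideanSpace.proj i : EuclideanSpace ℝ (Fin d) →L[ℝ] ℝ).intervalIntegral_comp_comm
    (ac_intervalIntegrable_deriv hγ)
  have h2 := (ac_apply hγ i).integral_deriv_eq_sub
  calc (∫ t in a..b, deriv γ t) i = ∫ t in a..b, deriv γ t i := h1.symm
    _ = ∫ t in a..b, deriv (fun t => γ t i) t := by
        refine intervalIntegral.integral_congr_ae ?_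
        filter_upwards [ac_ae_differentiableAt hγ] with t ht htm
        rw [deriv_euclidean_apply (ht (uIoc_subset_uIcc htm))]
    _ = (γ b - γ a) i := by rw [h2]; simp

/-- On each piece f is the integral of its derivative, hence also on the union, and the indefinite
integral of an integrable function is absolutely continuous. -/
theorem ac_trans_real {f : ℝ → ℝ} (hab : a ≤ b) (hbc : b ≤ c)
    (h1 : AbsolutelyContinuousOnInterval f a b) (h2 : AbsolutelyContinuousOnInterval f b c) :
    AbsolutelyContinuousOnInterval f a c := by
  have i1 := h1.intervalIntegrable_deriv
  have i2 := h2.intervalIntegrable_deriv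
  have h3 := (i1.trans i2).absolutelyContinuousOnInterval_intervalIntegral
    (c := a) left_mem_uIcc
  have h4 : AbsolutelyContinuousOnInterval (fun _ : ℝ => f a) a c :=
    (LipschitzWith.const (f a)).lipschitzOnWith.absolutelyContinuousOnInterval
  refine ac_congr (h4.fun_add h3) fun t ht => ?_
  rw [uIcc_of_le (hab.trans hbc)] at ht
  rcases le_total t b with htb | htb
  · have h5 := h1.mono (c := a) (d := t) (by
      rw [uIcc_of_le ht.1, uIcc_of_le hab]; exact Icc_subset_Icc_right htb)
    simp only [h5.integral_deriv_eq_sub]; ring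
  · have h5 := h2.mono (c := b) (d := t) (by
      rw [uIcc_of_le htb, uIcc_of_le hbc]; exact Icc_subset_Icc_right ht.2)
    change f a + ∫ v in a..t, deriv f v = f t
    rw [← intervalIntegral.integral_add_adjacent_intervals i1 h5.intervalIntegrable_deriv,
      h1.integral_deriv_eq_sub, h5.integral_deriv_eq_sub]
    ring

/-- Absolute continuity on two adjacent intervals gives absolute continuity on their union. -/
theorem ac_trans (hab : a ≤ b) (hbc : b ≤ c)
    (h1 : AbsolutelyContinuousOnInterval γ a b) (h2 : AbsolutelyContinuousOnInterval γ b c) :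
    AbsolutelyContinuousOnInterval γ a c :=
  ac_of_apply fun i => ac_trans_real hab hbc (ac_apply h1 i) (ac_apply h2 i)

theorem ac_lintegral_deriv_lt_top (hab : a ≤ b) (hγ : AbsolutelyContinuousOnInterval γ a b) :
    ∫⁻ t in Icc a b, ‖deriv γ t‖ₑ < ∞ := by
  have h := (intervalIntegrable_iff_integrableOn_Icc_of_le hab).1 (ac_intervalIntegrable_deriv hγ)
  exact h.2

/-- Along a path of constant direction, the displacement has that direction and its norm is the
length of the path. -/
theorem ac_sub_eq_smul_of_direction (hab : a ≤ b) (hγ : AbsolutelyContinuousOnInterval γ a b)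
    {u : EuclideanSpace ℝ (Fin d)} (h : ∀ᵐ t : ℝ, t ∈ Ioo a b → deriv γ t = ‖deriv γ t‖ • u) :
    ∃ l : ℝ, 0 ≤ l ∧ γ b - γ a = l • u ∧ ∫⁻ t in Icc a b, ‖deriv γ t‖ₑ = ENNReal.ofReal l := by
  have hi := (intervalIntegrable_iff_integrableOn_Icc_of_le hab).1 (ac_intervalIntegrable_deriv hγ)
  refine ⟨∫ t in Icc a b, ‖deriv γ t‖, integral_nonneg fun _ => norm_nonneg _, ?_, ?_⟩
  · rw [← ac_integral_deriv hγ, intervalIntegral.integral_of_le hab, integral_Icc_eq_integral_Ioo,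
      integral_Ioc_eq_integral_Ioo, ← integral_smul_const]
    refine integral_congr_ae ?_
    rw [Filter.EventuallyEq, ae_restrict_iff' measurableSet_Ioo]
    exact h
  · rw [ofReal_integral_eq_lintegral_ofReal hi.norm (Filter.Eventually.of_forall fun _ => norm_nonneg _)]
    simp_rw [ofReal_norm]

end AbsolutelyContinuous

/-- The derivative of any function vanishes almost everywhere on the preimage of a finite set. -/
theorem lintegral_enorm_deriv_eq_zero_of_mapsTo_finite {V : Type*} [NormedAddCommGroup V]
    [NormedSpace ℝ V] {γ : ℝ → V} {A : Set ℝ} {S : Set V} (hA : MeasurableSet A)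
    (hS : S.Finite) (h : MapsTo γ A S) :
    ∫⁻ t in A, ‖deriv γ t‖ₑ = 0 := by
  have key : ∀ s, ∀ᵐ t : ℝ, t ∈ A ∩ γ ⁻¹' {s} → deriv γ t = 0 := by
    intro s
    -- A point with nonzero derivative is isolated in its level set, and a set of reals has only
    -- countably many points isolated from the right.
    have hc := (countable_setOfPred_isolated_right_within (s := A ∩ γ ⁻¹' {s}))
    filter_upwards [hc.ae_notMem volume] with t ht htA
    by_contra hne
    have hd : DifferentiableAt ℝ γ t := differentiableAt_of_deriv_ne_zero hne
    have hev : ∀ᶠ z in nhdsWithin t {t}ᶜ, γ z ≠ s := hd.hasDerivAt.eventually_ne hne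
    apply ht
    refine ⟨htA, ?_⟩
    have : nhdsWithin t ((A ∩ γ ⁻¹' {s}) ∩ Ioi t) ≤ nhdsWithin t {t}ᶜ :=
      nhdsWithin_mono _ fun z hz => (ne_of_gt hz.2 : z ≠ t)
    rw [← Filter.empty_mem_iff_bot]
    filter_upwards [this hev, self_mem_nhdsWithin] with z hz hz2
    exact hz hz2.1.2
  have key2 : ∀ᵐ t : ℝ, t ∈ A → deriv γ t = 0 := by
    have := (ae_ball_iff hS.countable).2 fun s _ => key s
    filter_upwards [this] with t ht htA
    exact ht (γ t) (h htA) ⟨htA, rfl⟩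
  rw [setLIntegral_congr_fun_ae (g := 0) hA]
  · simp
  · filter_upwards [key2] with t ht htA
    simp [ht htA]

/-! ### Integrals over sets of times -/

section Hull

theorem lintegral_Icc_add_Icc {a b c : ℝ} (hab : a ≤ b) (hbc : b ≤ c) (g : ℝ → ℝ≥0∞) :
    ∫⁻ t in Icc a c, g t = (∫⁻ t in Icc a b, g t) + ∫⁻ t in Icc b c, g t := by
  rw [← Icc_union_Ioc_eq_Icc hab hbc, lintegral_union measurableSet_Ioc,
    setLIntegral_congr (Ioc_ae_eq_Icc (a := b) (b := c))]
  exact Set.disjoint_left.2 fun t h1 h2 => absurd h1.2 (not_le.2 h2.1)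

/-- An integral over a bounded set is controlled by the integrals over the intervals between its
points. -/
theorem lintegral_le_of_forall_Icc {S : Set ℝ} (hb : BddBelow S) (ha : BddAbove S)
    {g : ℝ → ℝ≥0∞} {C : ℝ≥0∞}
    (h : ∀ s ∈ S, ∀ t ∈ S, s ≤ t → ∫⁻ z in Icc s t, g z ≤ C) : ∫⁻ z in S, g z ≤ C := by
  rcases S.eq_empty_or_nonempty with rfl | hne
  · simp
  -- The intervals `Icc (u n) (v n)` increase and have their ends in S, and they exhaust S up to its
  -- infimum and supremum, which form a null set.
  obtain ⟨u, hu, hut, huS⟩ := exists_seq_tendsto_sInf hne hb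
  obtain ⟨v, hv, hvt, hvS⟩ := exists_seq_tendsto_sSup hne ha
  have hsub : S ⊆ {sInf S, sSup S} ∪ ⋃ n, Icc (u n) (v n) := by
    intro z hz
    rcases (csInf_le hb hz).eq_or_lt with h1 | h1
    · exact Or.inl (Or.inl h1.symm)
    rcases (le_csSup ha hz).eq_or_lt with h2 | h2
    · exact Or.inl (Or.inr h2)
    right
    obtain ⟨n, hn1, hn2⟩ := ((hut.eventually_lt_const h1).and (hvt.eventually_const_lt h2)).exists
    exact mem_iUnion.2 ⟨n, hn1.le, hn2.le⟩
  calc ∫⁻ z in S, g z ≤ ∫⁻ z in {sInf S, sSup S} ∪ ⋃ n, Icc (u n) (v n), g z :=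
        lintegral_mono_set hsub
    _ ≤ (∫⁻ z in {sInf S, sSup S}, g z) + ∫⁻ z in ⋃ n, Icc (u n) (v n), g z :=
        lintegral_union_le _ _ _
    _ = ∫⁻ z in ⋃ n, Icc (u n) (v n), g z := by
        rw [setLIntegral_measure_zero _ _ ((Set.toFinite _).measure_zero _), zero_add]
    _ = ⨆ n, ∫⁻ z in Icc (u n) (v n), g z :=
        setLIntegral_iUnion_of_directed _
          (directed_of_isDirected_le fun i j hij => Icc_subset_Icc (hu hij) (hv hij))
    _ ≤ C := by
        refine iSup_le fun n => ?_
        rcases le_or_gt (u n) (v n) with hn | hn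
        · exact h _ (huS n) _ (hvS n) hn
        · rw [Icc_eq_empty (not_le.2 hn)]; simp

end Hull

/-! ### Anchor times and straight flights -/

section Flights

variable {d : ℕ} {F : Set (EuclideanSpace ℝ (Fin d))} {x y : EuclideanSpace ℝ (Fin d)}
  {γ : ℝ → EuclideanSpace ℝ (Fin d)}

/-- The times at which the path `γ` is in `F`, together with the initial and final times. -/
def anchorTimes (F : Set (EuclideanSpace ℝ (Fin d))) (γ : ℝ → EuclideanSpace ℝ (Fin d)) : Set ℝ :=
  {t | t ∈ Icc (0 : ℝ) 1 ∧ (γ t ∈ F ∨ t = 0 ∨ t = 1)}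

/-- A time interval, possibly reduced to a point, between anchor times of `γ` and with no anchor
time in its interior. -/
structure IsFlight (F : Set (EuclideanSpace ℝ (Fin d))) (γ : ℝ → EuclideanSpace ℝ (Fin d))
    (a b : ℝ) : Prop where
  left : a ∈ anchorTimes F γ
  right : b ∈ anchorTimes F γ
  le : a ≤ b
  interior : ∀ t ∈ Ioo a b, t ∉ anchorTimes F γ

theorem IsFlight.refl {t : ℝ} (ht : t ∈ anchorTimes F γ) : IsFlight F γ t t :=
  ⟨ht, ht, le_rfl, fun s hs => by simp at hs⟩

theorem IsFlight.Icc_subset {a b : ℝ} (h : IsFlight F γ a b) : Icc a b ⊆ Icc 0 1 :=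
  Icc_subset_Icc h.left.1.1 h.right.1.2

theorem IsAdmissible.continuousOn (h : IsAdmissible F x y γ) : ContinuousOn γ (Icc 0 1) := by
  have := h.rectifiable.continuousOn
  rwa [uIcc_of_le zero_le_one] at this

theorem IsAdmissible.ac (h : IsAdmissible F x y γ) {a b : ℝ} (ha : 0 ≤ a) (hab : a ≤ b)
    (hb : b ≤ 1) : AbsolutelyContinuousOnInterval γ a b :=
  h.rectifiable.mono (by
    rw [uIcc_of_le hab, uIcc_of_le zero_le_one]; exact Icc_subset_Icc ha hb)

/-- Already for the empty interval, straightness asks for a unit vector. So there are no admissible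
paths when d = 0, a case set apart at the end. -/
theorem IsAdmissible.exists_unit (h : IsAdmissible F x y γ) :
    ∃ u : EuclideanSpace ℝ (Fin d), ‖u‖ = 1 := by
  obtain ⟨u, hu, -⟩ := h.straight 0 0 (by simp) (by simp [MapsTo])
  exact ⟨u, hu⟩

theorem IsAdmissible.isClosed_anchorTimes (hF : IsClosed F) (h : IsAdmissible F x y γ) :
    IsClosed (anchorTimes F γ) := by
  have h1 : anchorTimes F γ = (Icc 0 1 ∩ γ ⁻¹' F) ∪ {0, 1} := by
    ext t
    simp only [anchorTimes, mem_ofPred_eq, mem_union, mem_inter_iff, mem_preimage,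
      mem_insert_iff, mem_singleton_iff]
    constructor
    · rintro ⟨h1, h2 | h2⟩
      · exact Or.inl ⟨h1, h2⟩
      · exact Or.inr h2
    · rintro (⟨h1, h2⟩ | h2)
      · exact ⟨h1, Or.inl h2⟩
      · refine ⟨?_, Or.inr h2⟩
        rcases h2 with rfl | rfl <;> simp
  rw [h1]
  exact (h.continuousOn.preimage_isClosed_of_isClosed isClosed_Icc hF).union
    (Set.toFinite _).isClosed

theorem zero_mem_anchorTimes : (0 : ℝ) ∈ anchorTimes F γ := ⟨by simp, by simp⟩

theorem one_mem_anchorTimes : (1 : ℝ) ∈ anchorTimes F γ := ⟨by simp, by simp⟩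

/-- Since the anchor times form a closed set containing 0 and 1, there are a last one up to t and a
first one from t on. -/
theorem IsAdmissible.exists_flight (hF : IsClosed F) (h : IsAdmissible F x y γ) {t : ℝ}
    (ht : t ∈ Icc (0 : ℝ) 1) : ∃ a b, IsFlight F γ a b ∧ t ∈ Icc a b := by
  have hZ := h.isClosed_anchorTimes hF
  have hb1 : BddAbove (anchorTimes F γ ∩ Iic t) := ⟨t, fun s hs => hs.2⟩
  have hb2 : BddBelow (anchorTimes F γ ∩ Ici t) := ⟨t, fun s hs => hs.2⟩
  have h1 := (hZ.inter isClosed_Iic).csSup_mem ⟨0, zero_mem_anchorTimes, ht.1⟩ hb1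
  have h2 := (hZ.inter isClosed_Ici).csInf_mem ⟨1, one_mem_anchorTimes, ht.2⟩ hb2
  refine ⟨_, _, ⟨h1.1, h2.1, le_trans h1.2 h2.2, fun s hs hsZ => ?_⟩, h1.2, h2.2⟩
  rcases le_total s t with hst | hst
  · exact absurd (le_csSup hb1 ⟨hsZ, hst⟩) (not_le.2 hs.1)
  · exact absurd (csInf_le hb2 ⟨hsZ, hst⟩) (not_le.2 hs.2)

/-- Otherwise an end of one flight would be an anchor time interior to the other. This makes the
open flights a disjoint, hence countable, family. -/
theorem IsFlight.eq_of_mem_Ioo {a b a' b' t : ℝ} (h : IsFlight F γ a b) (h' : IsFlight F γ a' b')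
    (ht : t ∈ Ioo a b) (ht' : t ∈ Ioo a' b') : a = a' ∧ b = b' := by
  constructor
  · rcases lt_trichotomy a a' with h1 | h1 | h1
    · exact absurd h'.left (h.interior _ ⟨h1, ht'.1.trans ht.2⟩)
    · exact h1
    · exact absurd h.left (h'.interior _ ⟨h1, ht.1.trans ht'.2⟩)
  · rcases lt_trichotomy b b' with h1 | h1 | h1
    · exact absurd h.right (h'.interior _ ⟨ht'.1.trans ht.2, h1⟩)
    · exact h1
    · exact absurd h'.right (h.interior _ ⟨ht.1.trans ht'.2, h1⟩)

theorem IsFlight.mem_Ioo {a b t : ℝ} (h : IsFlight F γ a b) (ht : t ∈ Icc a b)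
    (htZ : t ∉ anchorTimes F γ) : t ∈ Ioo a b :=
  ⟨lt_of_le_of_ne ht.1 fun e => htZ (e ▸ h.left), lt_of_le_of_ne ht.2 fun e => htZ (e ▸ h.right)⟩

theorem IsFlight.exists_direction {a b : ℝ} (hγ : IsAdmissible F x y γ) (h : IsFlight F γ a b) :
    ∃ u : EuclideanSpace ℝ (Fin d), ‖u‖ = 1 ∧ ∀ s t, a ≤ s → s ≤ t → t ≤ b →
      ∃ l : ℝ, 0 ≤ l ∧ γ t - γ s = l • u ∧ ∫⁻ z in Icc s t, ‖deriv γ z‖ₑ = ENNReal.ofReal l := by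
  obtain ⟨u, hu, hd⟩ := hγ.straight a b (Ioo_subset_Icc_self.trans h.Icc_subset)
    fun t ht htF => h.interior t ht ⟨h.Icc_subset (Ioo_subset_Icc_self ht), Or.inl htF⟩
  refine ⟨u, hu, fun s t has hst htb => ?_⟩
  refine ac_sub_eq_smul_of_direction hst
    (hγ.ac (h.left.1.1.trans has) hst (htb.trans h.right.1.2)) ?_
  filter_upwards [hd] with z hz hzm
  exact hz ⟨has.trans_lt hzm.1, hzm.2.trans_le htb⟩

/-- A path of constant direction never turns back. This is where the straightness condition enters
the length estimates. -/
theorem IsFlight.lintegral_eq {a b s t : ℝ} (hγ : IsAdmissible F x y γ) (h : IsFlight F γ a b)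
    (has : a ≤ s) (hst : s ≤ t) (htb : t ≤ b) :
    ∫⁻ z in Icc s t, ‖deriv γ z‖ₑ = ENNReal.ofReal (dist (γ s) (γ t)) := by
  obtain ⟨u, hu, hd⟩ := h.exists_direction hγ
  obtain ⟨l, hl, h1, h2⟩ := hd s t has hst htb
  rw [h2, dist_comm, dist_eq_norm, h1, norm_smul, hu, Real.norm_of_nonneg hl, mul_one]

/-- Anchor points lie in K, and a flight stays on the segment between its two anchor points. The
degenerate flight of length zero is treated separately, to avoid dividing by its length. -/
theorem IsAdmissible.mem_of_convex {K : Set (EuclideanSpace ℝ (Fin d))} (hK : Convex ℝ K)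
    (hF : IsClosed F) (hFK : F ⊆ K) (hx : x ∈ K) (hy : y ∈ K) (h : IsAdmissible F x y γ) {t : ℝ}
    (ht : t ∈ Icc (0 : ℝ) 1) : γ t ∈ K := by
  have hZ : ∀ s ∈ anchorTimes F γ, γ s ∈ K := by
    rintro s ⟨-, h1 | rfl | rfl⟩
    · exact hFK h1
    · rwa [h.source]
    · rwa [h.target]
  obtain ⟨a, b, hab, hta⟩ := h.exists_flight hF ht
  obtain ⟨u, hu, hd⟩ := hab.exists_direction h
  obtain ⟨l, hl, h1, -⟩ := hd a t le_rfl hta.1 hta.2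
  obtain ⟨l', hl', h2, -⟩ := hd t b hta.1 hta.2 le_rfl
  rcases (add_nonneg hl hl').eq_or_lt with h0 | h0
  · have : l = 0 := by linarith
    rw [this, zero_smul, sub_eq_zero] at h1
    rw [h1]; exact hZ _ hab.left
  · have h3 := hK (hZ a hab.left) (hZ b hab.right) (div_nonneg hl' h0.le) (div_nonneg hl h0.le)
      (by field_simp; ring)
    convert h3 using 1
    rw [sub_eq_iff_eq_add] at h1 h2
    rw [h2, h1]
    match_scalars <;> field_simp <;> ring

end Flights

/-! ### Replacing a piece of a path by its chord -/

section Shortcut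

variable {d : ℕ} {F : Set (EuclideanSpace ℝ (Fin d))} {x y : EuclideanSpace ℝ (Fin d)}
  {γ : ℝ → EuclideanSpace ℝ (Fin d)}

/-- The length of `γ` over the set of times `S`, weighted by `f ^ β`. -/
noncomputable def weightedLength (f : EuclideanSpace ℝ (Fin d) → ℝ) (β : ℝ)
    (γ : ℝ → EuclideanSpace ℝ (Fin d)) (S : Set ℝ) : ℝ≥0∞ :=
  ∫⁻ t in S, ENNReal.ofReal (f (γ t) ^ β) * ‖deriv γ t‖ₑ

/-- The path `γ` with the part over `[s, t]` replaced by a line segment. -/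
noncomputable def shortcut (γ : ℝ → EuclideanSpace ℝ (Fin d)) (s t τ : ℝ) : EuclideanSpace ℝ (Fin d) :=
  if τ ∈ Icc s t then γ s + ((τ - s) / (t - s)) • (γ t - γ s) else γ τ

theorem shortcut_of_le {s t τ : ℝ} (h : τ ≤ s) : shortcut γ s t τ = γ τ := by
  unfold shortcut
  split_ifs with h1
  · rw [le_antisymm h h1.1]; simp
  · rfl

theorem shortcut_of_ge {s t τ : ℝ} (hst : s < t) (h : t ≤ τ) : shortcut γ s t τ = γ τ := by
  unfold shortcut
  split_ifs with h1
  · rw [le_antisymm h1.2 h, div_self (sub_pos.2 hst).ne']; simp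
  · rfl

theorem shortcut_of_mem {s t τ : ℝ} (h : τ ∈ Icc s t) :
    shortcut γ s t τ = γ s + ((τ - s) / (t - s)) • (γ t - γ s) := if_pos h

theorem deriv_shortcut_of_lt {s t τ : ℝ} (h : τ < s) :
    deriv (shortcut γ s t) τ = deriv γ τ := by
  refine Filter.EventuallyEq.deriv_eq ?_
  filter_upwards [Iio_mem_nhds h] with z hz using shortcut_of_le (le_of_lt hz)

theorem deriv_shortcut_of_gt {s t τ : ℝ} (hst : s < t) (h : t < τ) :
    deriv (shortcut γ s t) τ = deriv γ τ := by
  refine Filter.EventuallyEq.deriv_eq ?_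
  filter_upwards [Ioi_mem_nhds h] with z hz using shortcut_of_ge hst (le_of_lt hz)

theorem hasDerivAt_affine (v w : EuclideanSpace ℝ (Fin d)) (s t τ : ℝ) :
    HasDerivAt (fun τ : ℝ => v + ((τ - s) / (t - s)) • w) ((1 / (t - s)) • w) τ :=
  ((((hasDerivAt_id τ).sub_const s).div_const (t - s)).smul_const w).const_add v

theorem deriv_shortcut_of_mem {s t τ : ℝ} (h : τ ∈ Ioo s t) :
    deriv (shortcut γ s t) τ = (1 / (t - s)) • (γ t - γ s) := by
  rw [← (hasDerivAt_affine (γ s) (γ t - γ s) s t τ).deriv]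
  refine Filter.EventuallyEq.deriv_eq ?_
  filter_upwards [Ioo_mem_nhds h.1 h.2] with z hz using shortcut_of_mem (Ioo_subset_Icc_self hz)

theorem ac_affine (v w : EuclideanSpace ℝ (Fin d)) (s t a b : ℝ) :
    AbsolutelyContinuousOnInterval (fun τ : ℝ => v + ((τ - s) / (t - s)) • w) a b := by
  refine ContDiffOn.absolutelyContinuousOnInterval (ContDiff.contDiffOn ?_)
  fun_prop

/-- A vector is a nonnegative multiple of some unit vector, as soon as there are unit vectors. -/
theorem exists_unit_eq_norm_smul (h : ∃ u : EuclideanSpace ℝ (Fin d), ‖u‖ = 1)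
    (v : EuclideanSpace ℝ (Fin d)) :
    ∃ u : EuclideanSpace ℝ (Fin d), ‖u‖ = 1 ∧ v = ‖v‖ • u := by
  rcases eq_or_ne v 0 with rfl | hv
  · obtain ⟨u, hu⟩ := h
    exact ⟨u, hu, by simp⟩
  · refine ⟨‖v‖⁻¹ • v, ?_, ?_⟩
    · rw [norm_smul, norm_inv, norm_norm, inv_mul_cancel₀ (norm_ne_zero_iff.2 hv)]
    · rw [smul_smul, mul_inv_cancel₀ (norm_ne_zero_iff.2 hv), one_smul]

theorem exists_unit_eq_norm_smul_smul (h : ∃ u : EuclideanSpace ℝ (Fin d), ‖u‖ = 1)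
    (v : EuclideanSpace ℝ (Fin d)) : ∃ u : EuclideanSpace ℝ (Fin d), ‖u‖ = 1 ∧
      ∀ c : ℝ, 0 ≤ c → c • v = ‖c • v‖ • u := by
  obtain ⟨u, hu, hv⟩ := exists_unit_eq_norm_smul h v
  refine ⟨u, hu, fun c hc => ?_⟩
  rw [norm_smul, Real.norm_of_nonneg hc, mul_smul, ← hv]

/-- Replacing the part of an admissible path between two anchor times by a line segment yields an
admissible path. -/
theorem IsAdmissible.shortcut (h : IsAdmissible F x y γ) {s t : ℝ} (hs : s ∈ anchorTimes F γ)
    (ht : t ∈ anchorTimes F γ) (hst : s < t) : IsAdmissible F x y (shortcut γ s t) := by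
  have hs0 := hs.1.1
  have ht1 := ht.1.2
  refine ⟨?_, ?_, ?_, ?_⟩
  · refine ac_trans hs0 (hst.le.trans ht1) (b := s) ?_ (ac_trans hst.le ht1 (b := t) ?_ ?_)
    · refine ac_congr (h.ac le_rfl hs0 hs.1.2) fun z hz => ?_
      rw [uIcc_of_le hs0] at hz
      exact (shortcut_of_le hz.2).symm
    · refine ac_congr (ac_affine (γ s) (γ t - γ s) s t s t) fun z hz => ?_
      rw [uIcc_of_le hst.le] at hz
      exact (shortcut_of_mem hz).symm
    · refine ac_congr (h.ac ht.1.1 ht1 le_rfl) fun z hz => ?_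
      rw [uIcc_of_le ht1] at hz
      exact (shortcut_of_ge hst hz.1).symm
  · rw [shortcut_of_le hs0, h.source]
  · rw [shortcut_of_ge hst ht1, h.target]
  · intro a b hab hF
    rcases le_or_gt b a with hba | hba
    · obtain ⟨u, hu⟩ := h.exists_unit
      exact ⟨u, hu, by simp [Ioo_eq_empty (not_lt.2 hba)]⟩
    have hab' : Icc a b ⊆ Icc 0 1 := by
      rw [← closure_Ioo hba.ne]; exact closure_minimal hab isClosed_Icc
    have ha0 := (hab' (left_mem_Icc.2 hba.le)).1
    have hb1 := (hab' (right_mem_Icc.2 hba.le)).2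
    -- The shortcut still visits γ(s) and γ(t), so an open interval that it maps off F contains
    -- neither s nor t. It therefore lies entirely before, on or after the chord.
    have hout : ∀ z ∈ anchorTimes F γ, FermatDTM.shortcut γ s t z = γ z → z ∉ Ioo a b := by
      rintro z ⟨-, hzF | rfl | rfl⟩ hz hzab
      · exact hF hzab (hz ▸ hzF)
      · exact absurd hzab.1 (not_lt.2 ha0)
      · exact absurd hzab.2 (not_lt.2 hb1)
    have hs' := hout s hs (shortcut_of_le le_rfl)
    have ht' := hout t ht (shortcut_of_ge hst le_rfl)
    rcases le_or_gt b s with hbs | hbs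
    · obtain ⟨u, hu, hd⟩ := h.straight a b hab fun z hz => by
        have := hF hz; rwa [shortcut_of_le (hz.2.le.trans hbs)] at this
      refine ⟨u, hu, ?_⟩
      filter_upwards [hd] with z hz hzm
      rw [deriv_shortcut_of_lt (hzm.2.trans_le hbs)]
      exact hz hzm
    have has : s ≤ a := not_lt.1 fun h1 => hs' ⟨h1, hbs⟩
    rcases le_or_gt t a with hta | hta
    · obtain ⟨u, hu, hd⟩ := h.straight a b hab fun z hz => by
        have := hF hz; rwa [shortcut_of_ge hst (hta.trans hz.1.le)] at this
      refine ⟨u, hu, ?_⟩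
      filter_upwards [hd] with z hz hzm
      rw [deriv_shortcut_of_gt hst (hta.trans_lt hzm.1)]
      exact hz hzm
    have hbt : b ≤ t := not_lt.1 fun h1 => ht' ⟨hta, h1⟩
    obtain ⟨u, hu, hd⟩ := exists_unit_eq_norm_smul_smul h.exists_unit (γ t - γ s)
    refine ⟨u, hu, Filter.Eventually.of_forall fun z hz => ?_⟩
    rw [deriv_shortcut_of_mem ⟨has.trans_lt hz.1, hz.2.trans_le hbt⟩]
    exact hd _ (one_div_nonneg.2 (sub_pos.2 hst).le)

/-- The line segment is an admissible path. -/
theorem isAdmissible_segment (h : ∃ u : EuclideanSpace ℝ (Fin d), ‖u‖ = 1) :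
    IsAdmissible F x y (fun τ : ℝ => x + τ • (y - x)) := by
  have hd : ∀ τ : ℝ, HasDerivAt (fun τ : ℝ => x + τ • (y - x)) (y - x) τ := fun τ => by
    simpa using ((hasDerivAt_id τ).smul_const (y - x)).const_add x
  refine ⟨?_, by simp, by simp, fun a b _ _ => ?_⟩
  · refine ContDiffOn.absolutelyContinuousOnInterval (ContDiff.contDiffOn ?_)
    fun_prop
  · obtain ⟨u, hu, hv⟩ := exists_unit_eq_norm_smul h (y - x)
    exact ⟨u, hu, Filter.Eventually.of_forall fun τ _ => by rw [(hd τ).deriv]; exact hv⟩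

theorem setLIntegral_Ioo_eq_Icc {a b : ℝ} (g : ℝ → ℝ≥0∞) :
    ∫⁻ t in Ioo a b, g t = ∫⁻ t in Icc a b, g t := setLIntegral_congr Ioo_ae_eq_Icc

theorem weightedLength_shortcut_left {f : EuclideanSpace ℝ (Fin d) → ℝ} {β a s t : ℝ} :
    weightedLength f β (shortcut γ s t) (Icc a s) = weightedLength f β γ (Icc a s) := by
  unfold weightedLength
  rw [← setLIntegral_Ioo_eq_Icc, ← setLIntegral_Ioo_eq_Icc]
  refine setLIntegral_congr_fun measurableSet_Ioo fun z hz => ?_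
  simp only [shortcut_of_le hz.2.le, deriv_shortcut_of_lt hz.2]

theorem weightedLength_shortcut_right {f : EuclideanSpace ℝ (Fin d) → ℝ} {β b s t : ℝ}
    (hst : s < t) :
    weightedLength f β (shortcut γ s t) (Icc t b) = weightedLength f β γ (Icc t b) := by
  unfold weightedLength
  rw [← setLIntegral_Ioo_eq_Icc, ← setLIntegral_Ioo_eq_Icc]
  refine setLIntegral_congr_fun measurableSet_Ioo fun z hz => ?_
  simp only [shortcut_of_ge hst hz.1.le, deriv_shortcut_of_gt hst hz.1]

/-- Every point of the chord is within half of its length from one of the two ends, where f ≤ r. -/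
theorem weightedLength_shortcut_middle {f : EuclideanSpace ℝ (Fin d) → ℝ} {β s t r : ℝ}
    (hf : LipschitzWith 1 f) (hf0 : ∀ z, 0 ≤ f z) (hβ : 0 ≤ β) (hst : s < t)
    (hs : f (γ s) ≤ r) (ht : f (γ t) ≤ r) :
    weightedLength f β (shortcut γ s t) (Icc s t) ≤
      ENNReal.ofReal ((r + dist (γ s) (γ t) / 2) ^ β * dist (γ s) (γ t)) := by
  unfold weightedLength
  rw [← setLIntegral_Ioo_eq_Icc]
  set L := dist (γ s) (γ t) with hL
  have hL' : ‖γ t - γ s‖ = L := by rw [hL, dist_comm, dist_eq_norm]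
  have hL0 : 0 ≤ L := dist_nonneg
  have hts : 0 < t - s := sub_pos.2 hst
  have hr : 0 ≤ r := (hf0 _).trans hs
  have hlip : ∀ a b, f a ≤ f b + dist a b := fun a b => by
    have := hf.dist_le_mul a b
    rw [NNReal.coe_one, one_mul, Real.dist_eq] at this
    linarith [le_abs_self (f a - f b)]
  have hpt : ∀ z ∈ Ioo s t, ENNReal.ofReal (f (shortcut γ s t z) ^ β) *
      ‖deriv (shortcut γ s t) z‖ₑ ≤
      ENNReal.ofReal ((r + L / 2) ^ β) * ENNReal.ofReal (L / (t - s)) := by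
    intro z hz
    have h1 : f (shortcut γ s t z) ≤ r + L / 2 := by
      rw [shortcut_of_mem (Ioo_subset_Icc_self hz)]
      set θ := (z - s) / (t - s) with hθ
      have hθ0 : 0 ≤ θ := div_nonneg (sub_nonneg.2 hz.1.le) hts.le
      have hθ1 : θ ≤ 1 := (div_le_one hts).2 (by linarith [hz.2])
      have e1 : dist (γ s + θ • (γ t - γ s)) (γ s) = θ * L := by
        rw [dist_eq_norm, add_sub_cancel_left, norm_smul, Real.norm_of_nonneg hθ0, hL']
      have e2 : dist (γ s + θ • (γ t - γ s)) (γ t) = (1 - θ) * L := by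
        have : γ s + θ • (γ t - γ s) - γ t = (-(1 - θ)) • (γ t - γ s) := by module
        rw [dist_eq_norm, this, norm_smul, norm_neg,
          Real.norm_of_nonneg (sub_nonneg.2 hθ1), hL']
      have h2 := hlip (γ s + θ • (γ t - γ s)) (γ s)
      have h3 := hlip (γ s + θ • (γ t - γ s)) (γ t)
      rw [e1] at h2
      rw [e2] at h3
      nlinarith
    refine mul_le_mul' (ENNReal.ofReal_le_ofReal (Real.rpow_le_rpow (hf0 _) h1 hβ)) ?_
    rw [deriv_shortcut_of_mem hz, ← ofReal_norm, norm_smul, hL', Real.norm_of_nonneg (by positivity)]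
    exact ENNReal.ofReal_le_ofReal (by rw [one_div, div_eq_inv_mul])
  refine (setLIntegral_mono' measurableSet_Ioo hpt).trans ?_
  rw [setLIntegral_const, Real.volume_Ioo, ← ENNReal.ofReal_mul (by positivity),
    ← ENNReal.ofReal_mul (by positivity), mul_assoc, div_mul_cancel₀ _ hts.ne']

/-- Along an almost minimizing path, the weighted length between two anchor times is almost at most
that of the line segment. -/
theorem weightedLength_Icc_le_of_almost_minimizing {f : EuclideanSpace ℝ (Fin d) → ℝ} {β r : ℝ}
    {ε : ℝ≥0∞} (hf : LipschitzWith 1 f) (hf0 : ∀ z, 0 ≤ f z) (hβ : 0 ≤ β)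
    (h : IsAdmissible F x y γ) (hfin : weightedLength f β γ (Icc 0 1) ≠ ∞)
    (hmin : ∀ γ', IsAdmissible F x y γ' →
      weightedLength f β γ (Icc 0 1) ≤ weightedLength f β γ' (Icc 0 1) + ε)
    {s t : ℝ} (hsZ : s ∈ anchorTimes F γ) (htZ : t ∈ anchorTimes F γ) (hst : s ≤ t)
    (hs : f (γ s) ≤ r) (ht : f (γ t) ≤ r) :
    weightedLength f β γ (Icc s t) ≤
      ENNReal.ofReal ((r + dist (γ s) (γ t) / 2) ^ β * dist (γ s) (γ t)) + ε := by
  rcases hst.eq_or_lt with rfl | hst'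
  · simp [weightedLength]
  have hsplit : ∀ γ' : ℝ → EuclideanSpace ℝ (Fin d), weightedLength f β γ' (Icc 0 1) =
      weightedLength f β γ' (Icc 0 s) + weightedLength f β γ' (Icc s t) +
        weightedLength f β γ' (Icc t 1) := fun γ' => by
    unfold weightedLength
    rw [lintegral_Icc_add_Icc htZ.1.1 htZ.1.2, lintegral_Icc_add_Icc hsZ.1.1 hst]
  have hm := hmin _ (h.shortcut hsZ htZ hst')
  rw [hsplit] at hfin
  rw [hsplit γ, hsplit, weightedLength_shortcut_left, weightedLength_shortcut_right hst'] at hm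
  -- The two unchanged outer pieces have finite weighted length, so they can be cancelled.
  have hfin1 : weightedLength f β γ (Icc 0 s) + weightedLength f β γ (Icc t 1) ≠ ∞ := by
    refine ne_top_of_le_ne_top hfin ?_
    gcongr
    exact le_self_add
  have hm' : (weightedLength f β γ (Icc 0 s) + weightedLength f β γ (Icc t 1)) +
      weightedLength f β γ (Icc s t) ≤
      (weightedLength f β γ (Icc 0 s) + weightedLength f β γ (Icc t 1)) +
      (weightedLength f β (shortcut γ s t) (Icc s t) + ε) := by
    convert hm using 1 <;> ring
  refine ((ENNReal.add_le_add_iff_left hfin1).1 hm').trans ?_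
  gcongr
  exact weightedLength_shortcut_middle hf hf0 hβ hst' hs ht

end Shortcut

theorem lintegral_le_card_mul_of_subset_biUnion {ι : Type*} (T : Finset ι) {S : Set ℝ}
    (U : ι → Set ℝ) (g : ℝ → ℝ≥0∞) {C : ℝ≥0∞} (hS : S ⊆ ⋃ i ∈ T, U i)
    (h : ∀ i ∈ T, ∫⁻ t in U i, g t ≤ C) : ∫⁻ t in S, g t ≤ T.card * C := by
  classical
  induction T using Finset.induction_on generalizing S with
  | empty =>
    have : S = ∅ := by simpa using hS
    simp [this]
  | insert i T hi ih =>
    calc ∫⁻ t in S, g t ≤ ∫⁻ t in U i ∪ ⋃ i ∈ T, U i, g t :=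
          lintegral_mono_set (by simpa using hS)
      _ ≤ (∫⁻ t in U i, g t) + ∫⁻ t in ⋃ i ∈ T, U i, g t := lintegral_union_le _ _ _
      _ ≤ C + T.card * C := add_le_add (h i (by simp))
          (ih subset_rfl fun j hj => h j (Finset.mem_insert_of_mem hj))
      _ = (insert i T).card * C := by
          rw [Finset.card_insert_of_notMem hi]; push_cast; ring

/-! ### Length estimates over dyadic scales of the weight -/

section Scales

variable {d : ℕ} {F : Set (EuclideanSpace ℝ (Fin d))} {x y : EuclideanSpace ℝ (Fin d)}
  {γ : ℝ → EuclideanSpace ℝ (Fin d)} {f : EuclideanSpace ℝ (Fin d) → ℝ} {N β : ℝ}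

/-- A nonnegative `1`-Lipschitz function whose sublevel sets `{f ≤ r}` are covered by at most `N`
balls of radius `5 * r`. -/
structure IsCoverable (f : EuclideanSpace ℝ (Fin d) → ℝ) (N : ℝ) : Prop where
  lipschitz : LipschitzWith 1 f
  nonneg : ∀ z, 0 ≤ f z
  cover : ∀ r : ℝ, 0 < r → ∃ T : Finset (EuclideanSpace ℝ (Fin d)), (T.card : ℝ) ≤ N ∧
    ∀ z, f z ≤ r → ∃ w ∈ T, dist z w ≤ 5 * r

theorem IsCoverable.le_add_dist (hf : IsCoverable f N) (a b : EuclideanSpace ℝ (Fin d)) :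
    f a ≤ f b + dist a b := by
  have := hf.lipschitz.dist_le_mul a b
  rw [NNReal.coe_one, one_mul, Real.dist_eq] at this
  linarith [le_abs_self (f a - f b)]

/-- If ⌊N⌋ + 2 zeros had minimal distance D, covering at the level D/20 by at most N balls of radius
D/4 would put two of them in one ball, at distance at most D/2. -/
theorem IsCoverable.finite_zeros (hf : IsCoverable f N) : {z | f z = 0}.Finite := by
  by_contra hinf
  obtain ⟨S, hS, hcard⟩ := Set.Infinite.exists_subset_card_eq hinf (⌊N⌋₊ + 2)
  have hN : 0 ≤ N := by
    obtain ⟨T, hT, -⟩ := hf.cover 1 one_pos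
    exact (Nat.cast_nonneg _).trans hT
  obtain ⟨D, hD, hsep⟩ : ∃ D > 0, ∀ a ∈ S, ∀ b ∈ S, a ≠ b → D ≤ dist a b := by
    have hne : S.offDiag.Nonempty := by
      obtain ⟨a, ha, b, hb, hab⟩ := Finset.one_lt_card.1 (by omega : 1 < S.card)
      exact ⟨(a, b), Finset.mem_offDiag.2 ⟨ha, hb, hab⟩⟩
    obtain ⟨⟨a, b⟩, hab, hmin⟩ := Finset.exists_min_image S.offDiag (fun z => dist z.1 z.2) hne
    refine ⟨dist a b, dist_pos.2 (Finset.mem_offDiag.1 hab).2.2, fun a' ha' b' hb' h' => ?_⟩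
    exact hmin (a', b') (Finset.mem_offDiag.2 ⟨ha', hb', h'⟩)
  obtain ⟨T, hT, hcov⟩ := hf.cover (D / 20) (by positivity)
  have hz : ∀ z ∈ S, ∃ w ∈ T, dist z w ≤ 5 * (D / 20) := fun z hz =>
    hcov z (by rw [show f z = 0 from hS hz]; positivity)
  choose! g hgT hg using hz
  have hTc : T.card < S.card := by
    have := Nat.le_floor hT
    omega
  obtain ⟨a, ha, b, hb, hab, he⟩ := Finset.exists_ne_map_eq_of_card_lt_of_maps_to hTc hgT
  have h1 := hsep a ha b hb hab
  have h2 := dist_triangle_right a b (g a)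
  have h3 := hg a ha
  have h4 := hg b hb
  rw [← he] at h4
  linarith

/-- The times at which `γ` is on a flight along which `f ≤ r`. -/
def levelTimes (F : Set (EuclideanSpace ℝ (Fin d))) (f : EuclideanSpace ℝ (Fin d) → ℝ)
    (γ : ℝ → EuclideanSpace ℝ (Fin d)) (r : ℝ) : Set ℝ :=
  {t | ∃ a b, IsFlight F γ a b ∧ t ∈ Icc a b ∧ ∀ s ∈ Icc a b, f (γ s) ≤ r}

theorem levelTimes_subset {r : ℝ} : levelTimes F f γ r ⊆ Icc 0 1 := by
  rintro t ⟨a, b, hab, ht, -⟩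
  exact hab.Icc_subset ht

theorem le_of_mem_levelTimes {r t : ℝ} (h : t ∈ levelTimes F f γ r) : f (γ t) ≤ r := by
  obtain ⟨a, b, -, ht, h⟩ := h
  exact h t ht

/-- The length of the part of a flight where `f` is small. -/
theorem IsFlight.lintegral_low_le (hf : IsCoverable f N) (hγ : IsAdmissible F x y γ) {a b q : ℝ}
    (h : IsFlight F γ a b) (hq : 0 < q) :
    ∫⁻ t in {t | t ∈ Icc a b ∧ f (γ t) ≤ q}, ‖deriv γ t‖ₑ ≤ ENNReal.ofReal (10 * q * N) := by
  obtain ⟨T, hT, hcov⟩ := hf.cover q hq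
  have h1 : ∫⁻ t in {t | t ∈ Icc a b ∧ f (γ t) ≤ q}, ‖deriv γ t‖ₑ ≤
      T.card * ENNReal.ofReal (10 * q) := by
    refine lintegral_le_card_mul_of_subset_biUnion T
      (fun w => {t | t ∈ Icc a b ∧ dist (γ t) w ≤ 5 * q}) _ ?_ fun w _ => ?_
    · rintro t ⟨ht, htq⟩
      obtain ⟨w, hw, hd⟩ := hcov _ htq
      exact mem_iUnion₂.2 ⟨w, hw, ht, hd⟩
    -- The flight is straight, so its length between two times in a ball of radius 5q is a distance,
    -- at most 10q.
    · refine lintegral_le_of_forall_Icc ⟨a, fun t ht => ht.1.1⟩ ⟨b, fun t ht => ht.1.2⟩ ?_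
      intro s hs t ht hst
      rw [h.lintegral_eq hγ hs.1.1 hst ht.1.2]
      refine ENNReal.ofReal_le_ofReal ?_
      linarith [dist_triangle_right (γ s) (γ t) w, hs.2, ht.2]
  refine h1.trans ?_
  rw [← ENNReal.ofReal_natCast, ← ENNReal.ofReal_mul (Nat.cast_nonneg _)]
  refine ENNReal.ofReal_le_ofReal ?_
  nlinarith

theorem IsFlight.dist_le (hf : IsCoverable f N) (hN : 0 ≤ N) (hγ : IsAdmissible F x y γ)
    {a b r s t : ℝ} (h : IsFlight F γ a b) (hr : 0 < r) (hle : ∀ s ∈ Icc a b, f (γ s) ≤ r)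
    (has : a ≤ s) (hst : s ≤ t) (htb : t ≤ b) : dist (γ s) (γ t) ≤ 10 * r * N := by
  rw [← ENNReal.ofReal_le_ofReal_iff (by positivity), ← h.lintegral_eq hγ has hst htb]
  refine (lintegral_mono_set fun z hz => ?_).trans (h.lintegral_low_le hf hγ hr)
  have : z ∈ Icc a b := ⟨has.trans hz.1, hz.2.trans htb⟩
  exact ⟨this, hle z this⟩

theorem lintegral_le_mul_weightedLength {S : Set ℝ} (hS : MeasurableSet S) {q : ℝ} (hq : 0 < q)
    (hβ : 0 ≤ β) (h : ∀ t ∈ S, q ≤ f (γ t)) :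
    ∫⁻ t in S, ‖deriv γ t‖ₑ ≤ ENNReal.ofReal ((1 / q) ^ β) * weightedLength f β γ S := by
  unfold weightedLength
  rw [← lintegral_const_mul' _ _ ENNReal.ofReal_ne_top]
  refine setLIntegral_mono' hS fun t ht => ?_
  rw [← mul_assoc, ← ENNReal.ofReal_mul (by positivity),
    ← Real.mul_rpow (by positivity) (hq.le.trans (h t ht))]
  refine le_mul_of_one_le_left' ?_
  rw [ENNReal.one_le_ofReal]
  refine Real.one_le_rpow ?_ hβ
  rw [one_div, inv_mul_eq_div, le_div_iff₀ hq, one_mul]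
  exact h t ht

theorem weightedLength_mono {S T : Set ℝ} (h : S ⊆ T) :
    weightedLength f β γ S ≤ weightedLength f β γ T := lintegral_mono_set h

/-- The length of a flight is controlled by its weighted length and the maximum of `f` on it. -/
theorem IsFlight.lintegral_le (hf : IsCoverable f N) (hN : 2 ≤ N) (hβ : 0 ≤ β)
    (hγ : IsAdmissible F x y γ) {a b r s₀ : ℝ} (h : IsFlight F γ a b) (hr : 0 < r)
    (hs₀ : s₀ ∈ Icc a b) (hlt : r / 2 < f (γ s₀)) :
    ∫⁻ t in Icc a b, ‖deriv γ t‖ₑ ≤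
      ENNReal.ofReal (2 * (80 * N / r) ^ β) * weightedLength f β γ (Icc a b) := by
  have hN0 : 0 < N := by linarith
  -- With this q the part of the flight where f ≤ q has length at most 10qN = r/8, half of the
  -- threshold r/4 between short and long flights.
  set q : ℝ := r / (80 * N) with hq
  have hq0 : 0 < q := by positivity
  have hqN : 10 * q * N = r / 8 := by rw [hq]; field_simp; norm_num
  have hqr : q ≤ r / 4 := by
    rw [hq]; exact div_le_div_of_nonneg_left hr.le (by norm_num) (by linarith)
  have hinv : 80 * N / r = 1 / q := by rw [hq]; field_simp
  rw [hinv, ENNReal.ofReal_mul zero_le_two]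
  have hlen : ∫⁻ t in Icc a b, ‖deriv γ t‖ₑ = ENNReal.ofReal (dist (γ a) (γ b)) :=
    h.lintegral_eq hγ le_rfl h.le le_rfl
  -- On a flight shorter than r/4, the value above r/2 at s₀ and the Lipschitz bound keep f above
  -- r/4 ≥ q. On a longer one, the part where f ≤ q takes at most half of the length, and the rest
  -- pays for the whole with a factor 2.
  rcases lt_or_ge (dist (γ a) (γ b)) (r / 4) with hL | hL
  · have h1 : ∀ t ∈ Icc a b, q ≤ f (γ t) := by
      intro t ht
      have hd : dist (γ s₀) (γ t) ≤ dist (γ a) (γ b) := by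
        rw [← ENNReal.ofReal_le_ofReal_iff dist_nonneg, ← hlen]
        rcases le_total s₀ t with hst | hst
        · rw [← h.lintegral_eq hγ hs₀.1 hst ht.2]
          exact lintegral_mono_set (Icc_subset_Icc hs₀.1 ht.2)
        · rw [dist_comm, ← h.lintegral_eq hγ ht.1 hst hs₀.2]
          exact lintegral_mono_set (Icc_subset_Icc ht.1 hs₀.2)
      linarith [hf.le_add_dist (γ s₀) (γ t)]
    refine (lintegral_le_mul_weightedLength measurableSet_Icc hq0 hβ h1).trans ?_
    gcongr
    refine le_mul_of_one_le_left' ?_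
    norm_num
  · set B : Set ℝ := {t | t ∈ Icc a b ∧ f (γ t) ≤ q} with hB
    have hBc : IsClosed B :=
      ((hf.lipschitz.continuous.comp_continuousOn
        (hγ.continuousOn.mono h.Icc_subset)).preimage_isClosed_of_isClosed isClosed_Icc isClosed_Iic)
    have hBm := hBc.measurableSet
    have h1 : ∫⁻ t in B, ‖deriv γ t‖ₑ ≤ ENNReal.ofReal (dist (γ a) (γ b) / 2) := by
      refine (h.lintegral_low_le hf hγ hq0).trans (ENNReal.ofReal_le_ofReal ?_)
      rw [hqN]; linarith
    have h2 : ∫⁻ t in Icc a b \ B, ‖deriv γ t‖ₑ ≤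
        ENNReal.ofReal ((1 / q) ^ β) * weightedLength f β γ (Icc a b) := by
      refine (lintegral_le_mul_weightedLength (f := f) (measurableSet_Icc.diff hBm) hq0 hβ
        fun t ht => ?_).trans ?_
      · exact (not_le.1 fun h' => ht.2 ⟨ht.1, h'⟩).le
      · gcongr
        exact weightedLength_mono sdiff_subset
    have h3 : ∫⁻ t in Icc a b, ‖deriv γ t‖ₑ ≤
        ENNReal.ofReal (dist (γ a) (γ b) / 2) + ∫⁻ t in Icc a b \ B, ‖deriv γ t‖ₑ := by
      have hBs : B ⊆ Icc a b := fun t ht => ht.1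
      rw [← inter_union_sdiff (Icc a b) B, inter_eq_right.2 hBs]
      refine (lintegral_union_le _ _ _).trans ?_
      rw [union_sdiff_self, union_eq_right.2 hBs]
      gcongr
    rw [hlen] at h3 ⊢
    have h4 : ENNReal.ofReal (dist (γ a) (γ b)) =
        ENNReal.ofReal (dist (γ a) (γ b) / 2) + ENNReal.ofReal (dist (γ a) (γ b) / 2) := by
      rw [← ENNReal.ofReal_add (by positivity) (by positivity), add_halves]
    rw [h4, ENNReal.add_le_add_iff_left ENNReal.ofReal_ne_top] at h3
    rw [h4, ← two_mul, mul_assoc, ENNReal.ofReal_ofNat]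
    gcongr
    exact h3.trans h2

/-- The weighted length of an almost minimizing path over the flights along which `f ≤ r`. -/
theorem weightedLength_levelTimes_le {ε : ℝ≥0∞} {r : ℝ} (hf : IsCoverable f N) (hN : 2 ≤ N)
    (hβ : 0 ≤ β) (h : IsAdmissible F x y γ) (hfin : weightedLength f β γ (Icc 0 1) ≠ ∞)
    (hmin : ∀ γ', IsAdmissible F x y γ' →
      weightedLength f β γ (Icc 0 1) ≤ weightedLength f β γ' (Icc 0 1) + ε) (hr : 0 < r) :
    weightedLength f β γ (levelTimes F f γ r) ≤
      ENNReal.ofReal N * (ENNReal.ofReal ((13 * N * r) ^ β * (25 * N * r)) + ε) := by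
  obtain ⟨T, hT, hcov⟩ := hf.cover r hr
  have h1 : weightedLength f β γ (levelTimes F f γ r) ≤
      T.card * (ENNReal.ofReal ((13 * N * r) ^ β * (25 * N * r)) + ε) := by
    refine lintegral_le_card_mul_of_subset_biUnion T
      (fun w => {t | t ∈ levelTimes F f γ r ∧ dist (γ t) w ≤ 5 * r}) _ ?_ fun w _ => ?_
    · intro t ht
      obtain ⟨w, hw, hd⟩ := hcov _ (le_of_mem_levelTimes ht)
      exact mem_iUnion₂.2 ⟨w, hw, ht, hd⟩
    · refine lintegral_le_of_forall_Icc ⟨0, fun t ht => (levelTimes_subset ht.1).1⟩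
        ⟨1, fun t ht => (levelTimes_subset ht.1).2⟩ ?_
      rintro s ⟨⟨a, b, hab, hs, hsr⟩, hsw⟩ t ⟨⟨a', b', hab', ht, htr⟩, htw⟩ hst
      have hd1 := hab.dist_le hf (by linarith) h hr hsr le_rfl hs.1 hs.2
      have hd2 := hab'.dist_le hf (by linarith) h hr htr ht.1 ht.2 le_rfl
      -- Times are pushed out to the ends of their flights, which are anchor times, so that the
      -- chord is allowed. The distance is at most 10Nr + 10r + 10Nr, and 10r ≤ 5Nr as N ≥ 2; then r
      -- + 25Nr/2 ≤ 13Nr bounds f on the chord.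
      have hd : dist (γ a) (γ b') ≤ 25 * N * r := by
        have e1 := dist_triangle4 (γ a) (γ s) (γ t) (γ b')
        have e2 := dist_triangle_right (γ s) (γ t) w
        nlinarith
      refine (lintegral_mono_set (Icc_subset_Icc hs.1 ht.2)).trans
        ((weightedLength_Icc_le_of_almost_minimizing hf.lipschitz hf.nonneg hβ h hfin hmin hab.left
          hab'.right (hs.1.trans (hst.trans ht.2)) (hsr _ (left_mem_Icc.2 hab.le))
          (htr _ (right_mem_Icc.2 hab'.le))).trans ?_)
      gcongr
      nlinarith
  refine h1.trans ?_
  gcongr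
  rw [← ENNReal.ofReal_natCast]
  exact ENNReal.ofReal_le_ofReal hT

/-- The length of a path over the flights along which the maximum of `f` is between `r / 2` and
`r`. -/
theorem lintegral_levelTimes_diff_le {r : ℝ} (hf : IsCoverable f N) (hN : 2 ≤ N) (hβ : 0 ≤ β)
    (hF : IsClosed F) (h : IsAdmissible F x y γ) (hr : 0 < r) :
    ∫⁻ t in levelTimes F f γ r \ levelTimes F f γ (r / 2), ‖deriv γ t‖ₑ ≤
      ENNReal.ofReal (2 * (80 * N / r) ^ β) * weightedLength f β γ (levelTimes F f γ r) := by
  set C := ENNReal.ofReal (2 * (80 * N / r) ^ β) with hC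
  have hZ := h.isClosed_anchorTimes hF
  -- Up to the ends of flights, the times of this scale split into the open flights of J and the
  -- anchor times of P below. At the latter f itself exceeds r/2, since an anchor time alone is a
  -- degenerate flight.
  set J : Set (ℝ × ℝ) := {I | IsFlight F γ I.1 I.2 ∧ I.1 < I.2 ∧ (∀ s ∈ Icc I.1 I.2, f (γ s) ≤ r) ∧
    ∃ s ∈ Icc I.1 I.2, r / 2 < f (γ s)} with hJ
  set U : Set ℝ := ⋃ I ∈ J, Ioo I.1 I.2 with hU
  have hdisj : J.PairwiseDisjoint fun I => Ioo I.1 I.2 := by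
    intro I hI I' hI' hne
    refine Set.disjoint_left.2 fun t ht ht' => hne ?_
    obtain ⟨h1, h2⟩ := hI.1.eq_of_mem_Ioo hI'.1 ht ht'
    exact Prod.ext h1 h2
  have hcount : J.Countable := hdisj.countable_of_isOpen (fun I _ => isOpen_Ioo)
    fun I hI => nonempty_Ioo.2 hI.2.1
  have hUm : MeasurableSet U := .biUnion hcount fun _ _ => measurableSet_Ioo
  have hUlen : ∫⁻ t in U, ‖deriv γ t‖ₑ ≤ C * weightedLength f β γ U := by
    unfold weightedLength
    rw [hU, lintegral_biUnion hcount (fun _ _ => measurableSet_Ioo) hdisj,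
      lintegral_biUnion hcount (fun _ _ => measurableSet_Ioo) hdisj, ← ENNReal.tsum_mul_left]
    refine ENNReal.tsum_le_tsum fun ⟨I, hI⟩ => ?_
    obtain ⟨hI1, hI2, hI3, s, hs, hsr⟩ := hI
    rw [setLIntegral_Ioo_eq_Icc, setLIntegral_Ioo_eq_Icc]
    exact hI1.lintegral_le hf hN hβ h hr hs hsr
  set P : Set ℝ := {t | t ∈ anchorTimes F γ ∧ (f (γ t) ≤ r ∧ r / 2 < f (γ t))} with hP
  have hfγ : ContinuousOn (fun t => f (γ t)) (anchorTimes F γ) :=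
    hf.lipschitz.continuous.comp_continuousOn (h.continuousOn.mono fun t ht => ht.1)
  have hPm : MeasurableSet P := by
    have e1 : IsClosed (anchorTimes F γ ∩ (fun t => f (γ t)) ⁻¹' Iic r) :=
      hfγ.preimage_isClosed_of_isClosed hZ isClosed_Iic
    have e2 : IsClosed (anchorTimes F γ ∩ (fun t => f (γ t)) ⁻¹' Iic (r / 2)) :=
      hfγ.preimage_isClosed_of_isClosed hZ isClosed_Iic
    have : P = (anchorTimes F γ ∩ (fun t => f (γ t)) ⁻¹' Iic r) \
        (anchorTimes F γ ∩ (fun t => f (γ t)) ⁻¹' Iic (r / 2)) := by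
      ext t
      simp only [hP, mem_ofPred_eq, mem_sdiff, mem_inter_iff, mem_preimage, mem_Iic, not_and, not_le]
      tauto
    rw [this]
    exact e1.measurableSet.diff e2.measurableSet
  have hPlen : ∫⁻ t in P, ‖deriv γ t‖ₑ ≤ C * weightedLength f β γ P := by
    refine (lintegral_le_mul_weightedLength (f := f) hPm (half_pos hr) hβ
      fun t ht => ht.2.2.le).trans ?_
    gcongr
    refine ENNReal.ofReal_le_ofReal ?_
    have : (1 / (r / 2)) ^ β ≤ (80 * N / r) ^ β := by
      refine Real.rpow_le_rpow (by positivity) ?_ hβ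
      rw [one_div_div]
      gcongr
      linarith
    have h0 : 0 ≤ (80 * N / r) ^ β := Real.rpow_nonneg (by positivity) _
    linarith
  have hUP : Disjoint U P := by
    refine Set.disjoint_left.2 fun t ht htP => ?_
    obtain ⟨I, hI, htI⟩ := mem_iUnion₂.1 ht
    exact hI.1.interior t htI htP.1
  have hsub : levelTimes F f γ r \ levelTimes F f γ (r / 2) ⊆ U ∪ P := by
    rintro t ⟨⟨a, b, hab, ht, htr⟩, hnot⟩
    by_cases htZ : t ∈ anchorTimes F γ
    · refine Or.inr ⟨htZ, htr t ht, not_le.1 fun h' => hnot ⟨t, t, .refl htZ, ⟨le_rfl, le_rfl⟩, ?_⟩⟩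
      intro s hs
      rwa [le_antisymm hs.2 hs.1]
    · have ht' := hab.mem_Ioo ht htZ
      refine Or.inl (mem_iUnion₂.2 ⟨(a, b), ⟨hab, ht'.1.trans ht'.2, htr, ?_⟩, ht'⟩)
      by_contra hcon
      push Not at hcon
      exact hnot ⟨a, b, hab, ht, hcon⟩
  have hsub2 : U ∪ P ⊆ levelTimes F f γ r := by
    rintro t (ht | ht)
    · obtain ⟨I, hI, htI⟩ := mem_iUnion₂.1 ht
      exact ⟨I.1, I.2, hI.1, Ioo_subset_Icc_self htI, hI.2.2.1⟩
    · refine ⟨t, t, .refl ht.1, ⟨le_rfl, le_rfl⟩, fun s hs => ?_⟩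
      rw [le_antisymm hs.2 hs.1]
      exact ht.2.1
  calc ∫⁻ t in levelTimes F f γ r \ levelTimes F f γ (r / 2), ‖deriv γ t‖ₑ
      ≤ ∫⁻ t in U ∪ P, ‖deriv γ t‖ₑ := lintegral_mono_set hsub
    _ ≤ (∫⁻ t in U, ‖deriv γ t‖ₑ) + ∫⁻ t in P, ‖deriv γ t‖ₑ := lintegral_union_le _ _ _
    _ ≤ C * weightedLength f β γ U + C * weightedLength f β γ P := add_le_add hUlen hPlen
    _ = C * weightedLength f β γ (U ∪ P) := by
        unfold weightedLength
        rw [lintegral_union hPm hUP, mul_add]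
    _ ≤ C * weightedLength f β γ (levelTimes F f γ r) := by
        gcongr
        exact weightedLength_mono hsub2

/-- The powers r^β and r^(-β) of the two preceding estimates cancel, which leaves a bound linear in
r and so summable over dyadic scales. The error term instead grows like r^(-β), which is harmless
for exact minimizers or for finitely many scales. -/
theorem lintegral_scale_le {ε : ℝ≥0∞} {r : ℝ} (hf : IsCoverable f N) (hN : 2 ≤ N)
    (hβ : 0 ≤ β) (hF : IsClosed F) (h : IsAdmissible F x y γ)
    (hfin : weightedLength f β γ (Icc 0 1) ≠ ∞)
    (hmin : ∀ γ', IsAdmissible F x y γ' →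
      weightedLength f β γ (Icc 0 1) ≤ weightedLength f β γ' (Icc 0 1) + ε) (hr : 0 < r) :
    ∫⁻ t in levelTimes F f γ r \ levelTimes F f γ (r / 2), ‖deriv γ t‖ₑ ≤
      ENNReal.ofReal (50 * N ^ 2 * (1040 * N ^ 2) ^ β * r) +
        ENNReal.ofReal (2 * N * (80 * N / r) ^ β) * ε := by
  have hN0 : 0 < N := by linarith
  have h1 := weightedLength_levelTimes_le hf hN hβ h hfin hmin hr
  refine (lintegral_levelTimes_diff_le hf hN hβ hF h hr).trans ((mul_le_mul_right h1 _).trans_eq ?_)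
  rw [← mul_assoc, ← ENNReal.ofReal_mul (by positivity), mul_add,
    ← ENNReal.ofReal_mul (by positivity)]
  congr 2
  · have : 1040 * N ^ 2 = (80 * N / r) * (13 * N * r) := by field_simp; norm_num
    rw [this, Real.mul_rpow (x := 80 * N / r) (y := 13 * N * r) (by positivity) (by positivity)]
    ring
  · congr 1
    ring

theorem levelTimes_eq_Icc {R : ℝ} (hF : IsClosed F) (h : IsAdmissible F x y γ)
    (hR : ∀ t ∈ Icc (0 : ℝ) 1, f (γ t) ≤ R) : levelTimes F f γ R = Icc 0 1 := by
  refine levelTimes_subset.antisymm fun t ht => ?_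
  obtain ⟨a, b, hab, hta⟩ := h.exists_flight hF ht
  exact ⟨a, b, hab, hta, fun s hs => hR s (hab.Icc_subset hs)⟩

theorem sum_range_scale_le {A R : ℝ} (hA : 0 ≤ A) (hR : 0 ≤ R) (n : ℕ) :
    ∑ k ∈ Finset.range n, ENNReal.ofReal (A * (R / 2 ^ k)) ≤ ENNReal.ofReal (2 * A * R) := by
  rw [← ENNReal.ofReal_sum_of_nonneg fun k _ => by positivity]
  refine ENNReal.ofReal_le_ofReal ?_
  have h1 : ∑ k ∈ Finset.range n, A * (R / 2 ^ k) =
      A * R * ∑ k ∈ Finset.range n, (1 / 2 : ℝ) ^ k := by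
    rw [Finset.mul_sum]
    refine Finset.sum_congr rfl fun k _ => ?_
    rw [div_pow, one_pow]; ring
  rw [h1]
  nlinarith [sum_geometric_two_le n, mul_nonneg hA hR]

/-- The length of a minimizing path is controlled by the maximum of `f` on it. -/
theorem lintegral_deriv_le_of_minimizing {R : ℝ} (hf : IsCoverable f N) (hN : 2 ≤ N)
    (hβ : 0 ≤ β) (hF : IsClosed F) (h : IsAdmissible F x y γ)
    (hfin : weightedLength f β γ (Icc 0 1) ≠ ∞)
    (hmin : ∀ γ', IsAdmissible F x y γ' →
      weightedLength f β γ (Icc 0 1) ≤ weightedLength f β γ' (Icc 0 1)) (hR : 0 < R)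
    (hle : ∀ t ∈ Icc (0 : ℝ) 1, f (γ t) ≤ R) :
    ∫⁻ t in Icc (0 : ℝ) 1, ‖deriv γ t‖ₑ ≤
      ENNReal.ofReal (100 * N ^ 2 * (1040 * N ^ 2) ^ β * R) := by
  set A := 50 * N ^ 2 * (1040 * N ^ 2) ^ β with hA
  have hA0 : 0 ≤ A := by positivity
  -- These zeros account for the times that belong to the level sets of all scales.
  set Z : Set ℝ := Icc 0 1 ∩ (fun t => f (γ t)) ⁻¹' {0} with hZ
  have hZc : IsClosed Z := (hf.lipschitz.continuous.comp_continuousOn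
    h.continuousOn).preimage_isClosed_of_isClosed isClosed_Icc isClosed_singleton
  have hZ0 : ∫⁻ t in Z, ‖deriv γ t‖ₑ = 0 :=
    lintegral_enorm_deriv_eq_zero_of_mapsTo_finite hZc.measurableSet hf.finite_zeros
      fun t ht => ht.2
  have hsub : Icc (0 : ℝ) 1 ⊆ Z ∪ ⋃ k : ℕ, levelTimes F f γ (R / 2 ^ k) \
      levelTimes F f γ (R / 2 ^ k / 2) := by
    intro t ht
    by_cases hall : ∀ k : ℕ, t ∈ levelTimes F f γ (R / 2 ^ k)
    · refine Or.inl ⟨ht, le_antisymm ?_ (hf.nonneg _)⟩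
      have hlim : Filter.Tendsto (fun k : ℕ => R / 2 ^ k) Filter.atTop (nhds 0) := by
        have := (tendsto_pow_atTop_nhds_zero_of_lt_one (r := (1 / 2 : ℝ)) (by norm_num)
          (by norm_num)).const_mul R
        simpa [div_eq_mul_inv] using this
      exact ge_of_tendsto' hlim fun k => le_of_mem_levelTimes (hall k)
    · right
      push Not at hall
      classical
      -- The first scale whose level set misses t is not the zeroth, whose level set is the whole
      -- interval; t is counted at the scale just before.
      have hk := Nat.find_spec hall
      have hk0 : Nat.find hall ≠ 0 := by
        intro h0
        rw [h0, pow_zero, div_one, levelTimes_eq_Icc hF h hle] at hk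
        exact hk ht
      obtain ⟨k, hk1⟩ := Nat.exists_eq_succ_of_ne_zero hk0
      have hk2 : t ∈ levelTimes F f γ (R / 2 ^ k) := by
        by_contra hc
        have := Nat.find_min' hall hc
        omega
      refine mem_iUnion.2 ⟨k, hk2, ?_⟩
      rwa [hk1, Nat.succ_eq_add_one, pow_succ, ← div_div] at hk
  calc ∫⁻ t in Icc (0 : ℝ) 1, ‖deriv γ t‖ₑ
      ≤ _ := lintegral_mono_set hsub
    _ ≤ _ := lintegral_union_le _ _ _
    _ = ∫⁻ t in ⋃ k : ℕ, levelTimes F f γ (R / 2 ^ k) \ levelTimes F f γ (R / 2 ^ k / 2),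
          ‖deriv γ t‖ₑ := by rw [hZ0, zero_add]
    _ ≤ ∑' k : ℕ, ∫⁻ t in levelTimes F f γ (R / 2 ^ k) \ levelTimes F f γ (R / 2 ^ k / 2),
          ‖deriv γ t‖ₑ := lintegral_iUnion_le _ _
    _ ≤ ∑' k : ℕ, ENNReal.ofReal (A * (R / 2 ^ k)) := by
        refine ENNReal.tsum_le_tsum fun k => ?_
        have := lintegral_scale_le (ε := 0) hf hN hβ hF h hfin (by simpa using hmin)
          (r := R / 2 ^ k) (by positivity)
        simpa using this
    _ ≤ ENNReal.ofReal (2 * A * R) :=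
        ENNReal.tsum_le_of_sum_range_le fun n => sum_range_scale_le hA0 hR.le n
    _ = _ := by rw [hA]; ring_nf

theorem lintegral_levelTimes_le_sum (R : ℝ) (n : ℕ) :
    ∫⁻ t in levelTimes F f γ R, ‖deriv γ t‖ₑ ≤
      (∑ k ∈ Finset.range n, ∫⁻ t in levelTimes F f γ (R / 2 ^ k) \
        levelTimes F f γ (R / 2 ^ k / 2), ‖deriv γ t‖ₑ) +
      ∫⁻ t in levelTimes F f γ (R / 2 ^ n), ‖deriv γ t‖ₑ := by
  induction n with
  | zero => simp
  | succ n ih =>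
    refine ih.trans ?_
    rw [Finset.sum_range_succ, add_assoc, pow_succ, ← div_div]
    gcongr
    refine le_trans (lintegral_mono_set ?_) (lintegral_union_le _ _ _)
    intro t ht
    by_cases h : t ∈ levelTimes F f γ (R / 2 ^ n / 2)
    · exact Or.inr h
    · exact Or.inl ⟨ht, h⟩

/-- When `f` is bounded below by a positive number, sufficiently good almost minimizers have a
length controlled by any bound of `f`. -/
theorem exists_pos_lintegral_deriv_le {R δ η : ℝ} (hf : IsCoverable f N) (hN : 2 ≤ N)
    (hβ : 0 ≤ β) (hF : IsClosed F) (hR : 0 < R) (hδ : 0 < δ) (hδf : ∀ z, δ ≤ f z) (hη : 0 < η) :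
    ∃ ε₀ : ℝ, 0 < ε₀ ∧ ∀ ε : ℝ, ε ≤ ε₀ → ∀ γ, IsAdmissible F x y γ →
      weightedLength f β γ (Icc 0 1) ≠ ∞ →
      (∀ γ', IsAdmissible F x y γ' → weightedLength f β γ (Icc 0 1) ≤
        weightedLength f β γ' (Icc 0 1) + ENNReal.ofReal ε) →
      (∀ t ∈ Icc (0 : ℝ) 1, f (γ t) ≤ R) →
      ∫⁻ t in Icc (0 : ℝ) 1, ‖deriv γ t‖ₑ ≤
        ENNReal.ofReal (100 * N ^ 2 * (1040 * N ^ 2) ^ β * R + η) := by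
  have hN0 : 0 < N := by linarith
  -- Below δ the level sets are empty, so only n scales matter. Their error coefficients have a
  -- finite sum S, and ε ≤ η/(S + 1) keeps the total error below η.
  obtain ⟨n, hn⟩ := exists_pow_lt_of_lt_one (div_pos hδ hR) (by norm_num : (1 / 2 : ℝ) < 1)
  have hn' : R / 2 ^ n < δ := by
    rw [lt_div_iff₀ hR, div_pow, one_pow] at hn
    rwa [div_eq_mul_one_div, mul_comm]
  set S : ℝ := ∑ k ∈ Finset.range n, 2 * N * (80 * N / (R / 2 ^ k)) ^ β with hS
  have hS0 : 0 ≤ S := Finset.sum_nonneg fun k _ => by positivity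
  refine ⟨η / (S + 1), by positivity, fun ε hε γ h hfin hmin hle => ?_⟩
  set A := 50 * N ^ 2 * (1040 * N ^ 2) ^ β with hA
  have hA0 : 0 ≤ A := by positivity
  have hempty : levelTimes F f γ (R / 2 ^ n) = ∅ := by
    refine eq_empty_of_forall_notMem fun t ht => ?_
    linarith [le_of_mem_levelTimes ht, hδf (γ t)]
  calc ∫⁻ t in Icc (0 : ℝ) 1, ‖deriv γ t‖ₑ
      = ∫⁻ t in levelTimes F f γ R, ‖deriv γ t‖ₑ := by rw [levelTimes_eq_Icc hF h hle]
    _ ≤ ∑ k ∈ Finset.range n, ∫⁻ t in levelTimes F f γ (R / 2 ^ k) \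
        levelTimes F f γ (R / 2 ^ k / 2), ‖deriv γ t‖ₑ := by
        have := lintegral_levelTimes_le_sum (F := F) (f := f) (γ := γ) R n
        rwa [hempty, Measure.restrict_empty, lintegral_zero_measure, add_zero] at this
    _ ≤ ∑ k ∈ Finset.range n, (ENNReal.ofReal (A * (R / 2 ^ k)) +
          ENNReal.ofReal (2 * N * (80 * N / (R / 2 ^ k)) ^ β) * ENNReal.ofReal ε) :=
        Finset.sum_le_sum fun k _ =>
          lintegral_scale_le hf hN hβ hF h hfin hmin (by positivity)
    _ ≤ ENNReal.ofReal (2 * A * R) + ENNReal.ofReal S * ENNReal.ofReal (η / (S + 1)) := by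
        rw [Finset.sum_add_distrib, ← Finset.sum_mul, hS,
          ENNReal.ofReal_sum_of_nonneg fun k _ => by positivity]
        gcongr
        exact sum_range_scale_le hA0 hR.le n
    _ ≤ _ := by
        rw [← ENNReal.ofReal_mul hS0, ← ENNReal.ofReal_add (by positivity) (by positivity)]
        refine ENNReal.ofReal_le_ofReal ?_
        have h1 : S * (η / (S + 1)) ≤ η := by
          rw [mul_div_assoc', div_le_iff₀ (by positivity)]; nlinarith
        have h2 : 2 * A * R = 100 * N ^ 2 * (1040 * N ^ 2) ^ β * R := by rw [hA]; ring
        linarith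

end Scales

/-! ### The distance to a measure as an optimal partial transport cost -/

section DTM

variable {d : ℕ} {μ ν : Measure (EuclideanSpace ℝ (Fin d))} {x y : EuclideanSpace ℝ (Fin d)}
  {m p : ℝ}

theorem pseudoDTM_nonneg (u : ℝ) : 0 ≤ pseudoDTM μ u x :=
  Real.sInf_nonneg fun _ hr => hr.1.le

/-- Continuity from below of the mass of open balls. -/
theorem measure_ball_le_of_forall_lt {r : ℝ} {c : ℝ≥0∞}
    (h : ∀ r' < r, μ (Metric.ball x r') ≤ c) : μ (Metric.ball x r) ≤ c := by
  obtain ⟨v, hv, hvr, hvt⟩ := exists_seq_strictMono_tendsto r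
  have hU : Metric.ball x r ⊆ ⋃ n, Metric.ball x (v n) := by
    intro z hz
    obtain ⟨n, hn⟩ := (hvt.eventually_const_lt (Metric.mem_ball.1 hz)).exists
    exact mem_iUnion.2 ⟨n, hn⟩
  refine (measure_mono hU).trans ?_
  have hmono : Monotone fun n => Metric.ball x (v n) := fun i j hij =>
    Metric.ball_subset_ball (hv.monotone hij)
  rw [hmono.measure_iUnion]
  exact iSup_le fun n => h _ (hvr n)

/-- Continuity from above of the mass of open balls. -/
theorem le_measure_closedBall_of_forall_lt [IsFiniteMeasure μ] {a b : ℝ} (hab : a < b) {c : ℝ≥0∞}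
    (h : ∀ r, a < r → r ≤ b → c ≤ μ (Metric.ball x r)) : c ≤ μ (Metric.closedBall x a) := by
  obtain ⟨v, hv, hvr, hvt⟩ := exists_seq_strictAnti_tendsto' hab
  have hU : Metric.closedBall x a = ⋂ n, Metric.ball x (v n) := by
    ext z
    simp only [Metric.mem_closedBall, mem_iInter, Metric.mem_ball]
    exact ⟨fun hz n => hz.trans_lt (hvr n).1, fun hz => ge_of_tendsto' hvt fun n => (hz n).le⟩
  have hanti : Antitone fun n => Metric.ball x (v n) := fun i j hij =>
    Metric.ball_subset_ball (hv.antitone hij)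
  rw [hU, hanti.measure_iInter (fun n => measurableSet_ball.nullMeasurableSet)
    ⟨0, measure_ne_top _ _⟩]
  exact le_iInf fun n => h _ (hvr n).1 (hvr n).2.le

theorem pseudoDTM_le {u r : ℝ} (hr : 0 < r) (h : ENNReal.ofReal u < μ (Metric.ball x r)) :
    pseudoDTM μ u x ≤ r :=
  csInf_le ⟨0, fun _ hr => hr.1.le⟩ ⟨hr, h⟩

/-- Generalized inverse relation between radii and masses. The ball of radius D ensures that the
infimum is over a nonempty set; open balls are continuous from below, which gives the equivalence
with a non-strict inequality. -/
theorem le_pseudoDTM_iff {D u r : ℝ} (hD0 : 0 < D) (hD : ENNReal.ofReal u < μ (Metric.ball x D))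
    : r ≤ pseudoDTM μ u x ↔ μ (Metric.ball x r) ≤ ENNReal.ofReal u := by
  constructor
  · intro h
    refine measure_ball_le_of_forall_lt fun r' hr' => ?_
    rcases le_or_gt r' 0 with h0 | h0
    · rw [Metric.ball_eq_empty.2 h0]; simp
    · by_contra hcon
      linarith [pseudoDTM_le h0 (not_le.1 hcon)]
  · intro h
    refine le_csInf ⟨D, hD0, hD⟩ fun r' hr' => ?_
    by_contra hcon
    exact absurd hr'.2 (not_lt.2 ((measure_mono (Metric.ball_subset_ball (not_le.1 hcon).le)).trans h))

/-- The integral over `(0, m)` of the `p`-th powers of the pseudo distances to the measure. -/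
noncomputable def pseudoDTMIntegral (m p : ℝ) (μ : Measure (EuclideanSpace ℝ (Fin d)))
    (x : EuclideanSpace ℝ (Fin d)) : ℝ≥0∞ :=
  ∫⁻ u in Ioo 0 m, ENNReal.ofReal (pseudoDTM μ u x ^ p)

theorem ofReal_lt_measure_ball {D : ℝ} (hm1 : m ≤ 1) (hD : μ (Metric.ball x D) = 1) {u : ℝ}
    (hu : u ∈ Ioo 0 m) : ENNReal.ofReal u < μ (Metric.ball x D) := by
  rw [hD, ENNReal.ofReal_lt_one]
  exact hu.2.trans_le hm1

theorem aemeasurable_pseudoDTM {D : ℝ} (hm1 : m ≤ 1) (hD0 : 0 < D)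
    (hD : μ (Metric.ball x D) = 1) :
    AEMeasurable (fun u => pseudoDTM μ u x) (volume.restrict (Ioo 0 m)) := by
  refine aemeasurable_restrict_of_monotoneOn measurableSet_Ioo fun u _ v hv huv => ?_
  refine csInf_le_csInf ⟨0, fun _ hr => hr.1.le⟩ ⟨D, hD0, ofReal_lt_measure_ball hm1 hD hv⟩ ?_
  exact fun r hr => ⟨hr.1, (ENNReal.ofReal_le_ofReal huv).trans_lt hr.2⟩

theorem le_rpow_iff_rpow_one_div_le {s t : ℝ} (hp : 0 < p) (hs : 0 ≤ s) (ht : 0 ≤ t) :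
    s ≤ t ^ p ↔ s ^ (1 / p) ≤ t := by
  rw [one_div, Real.rpow_inv_le_iff_of_pos hs ht hp]

theorem volume_Ioo_inter_le {c : ℝ≥0∞} (hc : c ≠ ∞) :
    volume {u | u ∈ Ioo 0 m ∧ c ≤ ENNReal.ofReal u} = ENNReal.ofReal m - c := by
  lift c to NNReal using hc
  have hset : {u : ℝ | u ∈ Ioo 0 m ∧ (c : ℝ≥0∞) ≤ ENNReal.ofReal u} =ᵐ[volume] Ioo (c : ℝ) m := by
    have h1 : ∀ᵐ u : ℝ, u ≠ c := by simp [ae_iff]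
    filter_upwards [h1] with u hu
    refine propext ⟨fun ⟨h2, h3⟩ => ⟨lt_of_le_of_ne ?_ hu.symm, h2.2⟩, fun h2 => ?_⟩
    · rwa [← ENNReal.ofReal_coe_nnreal, ENNReal.ofReal_le_ofReal_iff h2.1.le] at h3
    · refine ⟨⟨lt_of_le_of_lt c.2 h2.1, h2.2⟩, ?_⟩
      rw [← ENNReal.ofReal_coe_nnreal]
      exact ENNReal.ofReal_le_ofReal h2.1.le
  rw [measure_congr hset, Real.volume_Ioo, ENNReal.ofReal_sub _ c.coe_nonneg, ENNReal.ofReal_coe_nnreal]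

/-- Layer cake formula for the distance to the measure. -/
theorem pseudoDTMIntegral_eq [IsProbabilityMeasure μ] {D : ℝ} (hm1 : m ≤ 1) (hp : 0 < p)
    (hD0 : 0 < D) (hD : μ (Metric.ball x D) = 1) :
    pseudoDTMIntegral m p μ x =
      ∫⁻ s in Ioi (0 : ℝ), (ENNReal.ofReal m - μ (Metric.ball x (s ^ (1 / p)))) := by
  unfold pseudoDTMIntegral
  rw [lintegral_eq_lintegral_meas_le _
    (Filter.Eventually.of_forall fun u => Real.rpow_nonneg (pseudoDTM_nonneg u) p)
    ((aemeasurable_pseudoDTM hm1 hD0 hD).pow_const p)]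
  refine setLIntegral_congr_fun measurableSet_Ioi fun s hs => ?_
  have hs0 : (0 : ℝ) < s := hs
  rw [← volume_Ioo_inter_le (measure_ne_top μ _)]
  rw [Measure.restrict_apply' measurableSet_Ioo]
  congr 1
  ext u
  simp only [mem_inter_iff, mem_ofPred_eq]
  rw [and_comm]
  refine and_congr_right fun hu => ?_
  rw [le_rpow_iff_rpow_one_div_le hp hs0.le (pseudoDTM_nonneg u)]
  exact le_pseudoDTM_iff hD0 (ofReal_lt_measure_ball hm1 hD hu)

theorem lintegral_enorm_sub_rpow_eq (hp : 0 < p) (μ' : Measure (EuclideanSpace ℝ (Fin d))) :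
    ∫⁻ z, ‖z - x‖ₑ ^ p ∂μ' =
      ∫⁻ s in Ioi (0 : ℝ), μ' (Metric.ball x (s ^ (1 / p)))ᶜ := by
  have h1 : ∀ z : EuclideanSpace ℝ (Fin d), ‖z - x‖ₑ ^ p = ENNReal.ofReal (dist z x ^ p) := by
    intro z
    rw [dist_eq_norm, ← ofReal_norm, ENNReal.ofReal_rpow_of_nonneg (norm_nonneg _) hp.le]
  simp_rw [h1]
  rw [lintegral_eq_lintegral_meas_le _
    (Filter.Eventually.of_forall fun u => Real.rpow_nonneg dist_nonneg p)
    (by fun_prop)]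
  refine setLIntegral_congr_fun measurableSet_Ioi fun s hs => ?_
  congr 1
  ext z
  simp only [mem_ofPred_eq, mem_compl_iff, Metric.mem_ball, not_lt]
  exact le_rpow_iff_rpow_one_div_le hp (le_of_lt hs) dist_nonneg

/-- The distance to `μ` minimizes the transport cost of submeasures of `μ` of mass `m`. -/
theorem pseudoDTMIntegral_le [IsProbabilityMeasure μ] {D : ℝ} (hm1 : m ≤ 1)
    (hp : 0 < p) (hD0 : 0 < D) (hD : μ (Metric.ball x D) = 1)
    {μ' : Measure (EuclideanSpace ℝ (Fin d))} (hle : μ' ≤ μ) (hmass : μ' univ = ENNReal.ofReal m) :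
    pseudoDTMIntegral m p μ x ≤ ∫⁻ z, ‖z - x‖ₑ ^ p ∂μ' := by
  have : IsFiniteMeasure μ' := ⟨by rw [hmass]; exact ENNReal.ofReal_lt_top⟩
  rw [pseudoDTMIntegral_eq hm1 hp hD0 hD, lintegral_enorm_sub_rpow_eq hp]
  refine lintegral_mono fun s => ?_
  -- Outside a ball, μ' has mass m - μ'(ball), which is at least m - μ(ball): the integrands of the
  -- two layer cake formulas compare pointwise.
  rw [measure_compl measurableSet_ball (measure_ne_top _ _), hmass]
  exact tsub_le_tsub_left (hle _) _

/-- The radius is an m-quantile of the distance to x, found as a supremum of radii. The cap r ≤ D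
keeps these radii bounded when m = 1. -/
theorem exists_radius [IsFiniteMeasure ν] {D : ℝ} (hm1 : m ≤ 1) (hD0 : 0 < D)
    (hD : ν (Metric.ball x D) = 1) : ∃ a : ℝ, ν (Metric.ball x a) ≤ ENNReal.ofReal m ∧
      ENNReal.ofReal m ≤ ν (Metric.closedBall x a) := by
  set A : Set ℝ := {r | r ≤ D ∧ ν (Metric.ball x r) ≤ ENNReal.ofReal m} with hA
  have hA0 : (0 : ℝ) ∈ A := ⟨hD0.le, by simp⟩
  have hAb : BddAbove A := ⟨D, fun r hr => hr.1⟩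
  refine ⟨sSup A, measure_ball_le_of_forall_lt fun r hr => ?_, ?_⟩
  · obtain ⟨r', hr', hlt⟩ := exists_lt_of_lt_csSup ⟨0, hA0⟩ hr
    exact (measure_mono (Metric.ball_subset_ball hlt.le)).trans hr'.2
  · rcases (csSup_le ⟨0, hA0⟩ fun r hr => hr.1 : sSup A ≤ D).eq_or_lt with h | h
    · rw [h]
      refine le_trans ?_ (measure_mono Metric.ball_subset_closedBall)
      rw [hD]
      exact ENNReal.ofReal_le_one.2 hm1
    · refine le_measure_closedBall_of_forall_lt h fun r hr hrD => ?_
      by_contra hcon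
      exact absurd (le_csSup hAb ⟨hrD, (not_le.1 hcon).le⟩) (not_le.2 hr)

/-- There is a submeasure of `ν` of mass `m`, given by a density, whose transport cost to a point
is given by the distance to `ν`. -/
theorem exists_density [IsProbabilityMeasure ν] {D : ℝ} (hm1 : m ≤ 1)
    (hp : 0 < p) (hD0 : 0 < D) (hD : ν (Metric.ball x D) = 1) :
    ∃ h : EuclideanSpace ℝ (Fin d) → ℝ≥0∞, Measurable h ∧ (∀ z, h z ≤ 1) ∧
      ν.withDensity h univ = ENNReal.ofReal m ∧
      ∫⁻ z, ‖z - x‖ₑ ^ p ∂(ν.withDensity h) ≤ pseudoDTMIntegral m p ν x := by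
  obtain ⟨a, ha1, ha2⟩ := exists_radius (x := x) hm1 hD0 hD
  set B := Metric.ball x a with hB
  set S := Metric.sphere x a with hS
  have hBS : ν (Metric.closedBall x a) = ν B + ν S := by
    rw [← Metric.ball_union_sphere, measure_union Metric.sphere_disjoint_ball.symm
      Metric.isClosed_sphere.measurableSet]
  -- The open ball may have mass below m, and the fraction θ of the sphere supplies the rest. If the
  -- sphere is null, nothing is missing and θ = 0.
  set θ : ℝ≥0∞ := (ENNReal.ofReal m - ν B) / ν S with hθ
  have hle : ENNReal.ofReal m - ν B ≤ ν S := by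
    rw [tsub_le_iff_left, ← hBS]; exact ha2
  have hθ1 : θ ≤ 1 := ENNReal.div_le_of_le_mul (by rwa [one_mul])
  have hθS : θ * ν S = ENNReal.ofReal m - ν B := by
    rcases eq_or_ne (ν S) 0 with h0 | h0
    · rw [h0] at hle ⊢
      rw [mul_zero]; exact (le_antisymm hle bot_le).symm
    · exact ENNReal.div_mul_cancel h0 (measure_ne_top _ _)
  set h : EuclideanSpace ℝ (Fin d) → ℝ≥0∞ := B.indicator 1 + S.indicator fun _ => θ with hh
  have hBm : MeasurableSet B := measurableSet_ball
  have hSm : MeasurableSet S := Metric.isClosed_sphere.measurableSet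
  have hmeas : Measurable h := (measurable_one.indicator hBm).add (measurable_const.indicator hSm)
  have hBSd : ∀ z ∈ B, z ∉ S := fun z hz hz' =>
    Set.disjoint_left.1 Metric.sphere_disjoint_ball.symm hz hz'
  have hmass : ν.withDensity h univ = ENNReal.ofReal m := by
    rw [withDensity_apply _ MeasurableSet.univ, Measure.restrict_univ, hh]
    simp only [Pi.add_apply]
    rw [lintegral_add_left (measurable_one.indicator hBm), lintegral_indicator_one hBm,
      lintegral_indicator_const hSm, hθS, add_tsub_cancel_of_le ha1]
  refine ⟨h, hmeas, fun z => ?_, hmass, ?_⟩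
  · by_cases hz : z ∈ B
    · simp [hh, hz, hBSd z hz]
    · by_cases hz' : z ∈ S
      · simp [hh, hz, hz', hθ1]
      · simp [hh, hz, hz']
  · have : IsFiniteMeasure (ν.withDensity h) := ⟨by rw [hmass]; exact ENNReal.ofReal_lt_top⟩
    rw [pseudoDTMIntegral_eq hm1 hp hD0 hD, lintegral_enorm_sub_rpow_eq hp]
    refine lintegral_mono fun s => ?_
    -- Up to the radius a the density is 1 on the ball, so both integrands agree; beyond a the
    -- submeasure has no mass outside the ball.
    rcases le_or_gt (s ^ (1 / p)) a with hsa | hsa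
    · rw [measure_compl measurableSet_ball (measure_ne_top _ _), hmass]
      refine tsub_le_tsub_left (le_of_eq ?_) _
      rw [withDensity_apply _ measurableSet_ball, ← setLIntegral_one]
      refine setLIntegral_congr_fun measurableSet_ball fun z hz => ?_
      have hzB : z ∈ B := Metric.ball_subset_ball hsa hz
      simp [hh, hzB, hBSd z hzB]
    · rw [withDensity_apply _ measurableSet_ball.compl]
      have : ∫⁻ z in (Metric.ball x (s ^ (1 / p)))ᶜ, h z ∂ν = 0 := by
        rw [setLIntegral_congr_fun (g := fun _ => 0) measurableSet_ball.compl]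
        · simp
        · intro z hz
          have hz' : a < dist z x := hsa.trans_le (not_lt.1 hz)
          have h1 : z ∉ B := fun hzB => absurd (Metric.mem_ball.1 hzB) (not_lt.2 hz'.le)
          have h2 : z ∉ S := fun hzS => hz'.ne' (Metric.mem_sphere.1 hzS)
          simp [hh, h1, h2]
      rw [this]; exact bot_le

/-- Comparison of the distances to the two marginals of a coupling. -/
theorem pseudoDTMIntegral_rpow_le_of_coupling [IsProbabilityMeasure μ] [IsProbabilityMeasure ν]
    {D D' : ℝ} (hm1 : m ≤ 1) (hp : 1 ≤ p) (hD0 : 0 < D)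
    (hD : μ (Metric.ball x D) = 1) (hD0' : 0 < D') (hD' : ν (Metric.ball y D') = 1)
    {π : Measure (EuclideanSpace ℝ (Fin d) × EuclideanSpace ℝ (Fin d))}
    (h1 : π.fst = μ) (h2 : π.snd = ν) :
    ∃ σ : Measure (EuclideanSpace ℝ (Fin d) × EuclideanSpace ℝ (Fin d)), σ ≤ π ∧
      σ univ = ENNReal.ofReal m ∧ σ ≪ π ∧
      pseudoDTMIntegral m p μ x ^ (1 / p) ≤ pseudoDTMIntegral m p ν y ^ (1 / p) +
        (∫⁻ z, ‖(z.1 - x) - (z.2 - y)‖ₑ ^ p ∂σ) ^ (1 / p) := by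
  have hp0 : 0 < p := by linarith
  obtain ⟨h, hmeas, hle1, hmass, hcost⟩ := exists_density hm1 hp0 hD0' hD'
  have hmeas2 : Measurable fun z : EuclideanSpace ℝ (Fin d) × EuclideanSpace ℝ (Fin d) => h z.2 :=
    hmeas.comp measurable_snd
  -- Weighting the coupling by a density of the second coordinate makes the second marginal the
  -- optimal submeasure of ν. The first marginal is then a submeasure of μ of mass m, hence a
  -- competitor, and Minkowski compares the two costs.
  set σ := π.withDensity fun z => h z.2 with hσ
  have hσπ : σ ≤ π := by
    rw [hσ]
    conv_rhs => rw [← withDensity_one (μ := π)]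
    exact withDensity_mono (Filter.Eventually.of_forall fun z => hle1 _)
  have hsnd : σ.snd = ν.withDensity h := by
    ext A hA
    rw [Measure.snd_apply hA, hσ, withDensity_apply _ (measurable_snd hA),
      withDensity_apply _ hA, ← h2, Measure.snd,
      setLIntegral_map hA hmeas measurable_snd]
  have hfst : σ.fst ≤ μ := by
    rw [← h1]
    exact Measure.map_mono hσπ measurable_fst
  have hσm : σ univ = ENNReal.ofReal m := by rw [← Measure.snd_univ, hsnd, hmass]
  refine ⟨σ, hσπ, hσm, withDensity_absolutelyContinuous _ _, ?_⟩
  have e1 : pseudoDTMIntegral m p μ x ≤ ∫⁻ z, ‖z.1 - x‖ₑ ^ p ∂σ := by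
    refine (pseudoDTMIntegral_le hm1 hp0 hD0 hD hfst (by rw [Measure.fst_univ, hσm])).trans_eq ?_
    rw [Measure.fst, lintegral_map (by fun_prop) measurable_fst]
  have e2 : ∫⁻ z, ‖z.2 - y‖ₑ ^ p ∂σ ≤ pseudoDTMIntegral m p ν y := by
    refine le_trans (le_of_eq ?_) hcost
    rw [← hsnd, Measure.snd, lintegral_map (by fun_prop) measurable_snd]
  calc pseudoDTMIntegral m p μ x ^ (1 / p) ≤ (∫⁻ z, ‖z.1 - x‖ₑ ^ p ∂σ) ^ (1 / p) := by gcongr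
    _ ≤ (∫⁻ z, ((fun z : EuclideanSpace ℝ (Fin d) × EuclideanSpace ℝ (Fin d) => ‖z.2 - y‖ₑ) +
          fun z : EuclideanSpace ℝ (Fin d) × EuclideanSpace ℝ (Fin d) =>
            ‖(z.1 - x) - (z.2 - y)‖ₑ) z ^ p ∂σ) ^ (1 / p) := by
        gcongr with z
        simp only [Pi.add_apply]
        calc ‖z.1 - x‖ₑ = ‖(z.2 - y) + ((z.1 - x) - (z.2 - y))‖ₑ := by rw [add_sub_cancel]
          _ ≤ _ := enorm_add_le _ _
    _ ≤ (∫⁻ z, ‖z.2 - y‖ₑ ^ p ∂σ) ^ (1 / p) +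
        (∫⁻ z, ‖(z.1 - x) - (z.2 - y)‖ₑ ^ p ∂σ) ^ (1 / p) :=
        ENNReal.lintegral_Lp_add_le (by fun_prop) (by fun_prop) hp
    _ ≤ _ := by gcongr

end DTM

/-! ### Regularity, covering and stability of the distance to a measure -/

section DTMEstimates

variable {d : ℕ} {μ ν : Measure (EuclideanSpace ℝ (Fin d))} {x y : EuclideanSpace ℝ (Fin d)}
  {m p : ℝ}

theorem dtm_nonneg (hm0 : 0 < m) : 0 ≤ dtm m p μ x := by
  refine Real.rpow_nonneg (mul_nonneg (by positivity) ?_) _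
  exact intervalIntegral.integral_nonneg hm0.le fun u _ => Real.rpow_nonneg (pseudoDTM_nonneg u) p

theorem pseudoDTMIntegral_le_of_ball {D : ℝ} (hm1 : m ≤ 1) (hp : 0 < p)
    (hD0 : 0 < D) (hD : μ (Metric.ball x D) = 1) :
    pseudoDTMIntegral m p μ x ≤ ENNReal.ofReal (D ^ p) * ENNReal.ofReal m := by
  unfold pseudoDTMIntegral
  refine (setLIntegral_mono' (g := fun _ => ENNReal.ofReal (D ^ p)) measurableSet_Ioo
    fun u hu => ENNReal.ofReal_le_ofReal ?_).trans ?_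
  · exact Real.rpow_le_rpow (pseudoDTM_nonneg u)
      (pseudoDTM_le hD0 (ofReal_lt_measure_ball hm1 hD hu)) hp.le
  · rw [setLIntegral_const, Real.volume_Ioo, sub_zero]

theorem ofReal_dtm_mul {D : ℝ} (hm0 : 0 < m) (hm1 : m ≤ 1) (hp : 0 < p)
    (hD0 : 0 < D) (hD : μ (Metric.ball x D) = 1) :
    ENNReal.ofReal (dtm m p μ x) * ENNReal.ofReal m ^ (1 / p) =
      pseudoDTMIntegral m p μ x ^ (1 / p) := by
  have hfin : pseudoDTMIntegral m p μ x ≠ ∞ :=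
    ne_top_of_le_ne_top (ENNReal.mul_ne_top ENNReal.ofReal_ne_top ENNReal.ofReal_ne_top)
      (pseudoDTMIntegral_le_of_ball hm1 hp hD0 hD)
  have hI : ∫ u in (0 : ℝ)..m, pseudoDTM μ u x ^ p = (pseudoDTMIntegral m p μ x).toReal := by
    rw [intervalIntegral.integral_of_le hm0.le, integral_Ioc_eq_integral_Ioo,
      integral_eq_lintegral_of_nonneg_ae
        (Filter.Eventually.of_forall fun u => Real.rpow_nonneg (pseudoDTM_nonneg u) p)
        ((aemeasurable_pseudoDTM hm1 hD0 hD).pow_const p).aestronglyMeasurable]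
    rfl
  have hp' : 0 ≤ 1 / p := by positivity
  unfold dtm
  rw [hI, ← ENNReal.ofReal_rpow_of_nonneg (by positivity) hp',
    ← ENNReal.mul_rpow_of_nonneg _ _ hp', ENNReal.ofReal_mul (by positivity),
    ENNReal.ofReal_toReal hfin, mul_right_comm, ← ENNReal.ofReal_mul (by positivity),
    one_div_mul_cancel hm0.ne', ENNReal.ofReal_one, one_mul]

theorem ofReal_rpow_ne_zero (hm0 : 0 < m) (q : ℝ) : ENNReal.ofReal m ^ q ≠ 0 := by
  rw [ENNReal.ofReal_rpow_of_pos hm0]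
  exact (ENNReal.ofReal_pos.2 (by positivity)).ne'

theorem ofReal_rpow_ne_top (hm0 : 0 < m) (q : ℝ) : ENNReal.ofReal m ^ q ≠ ∞ := by
  rw [ENNReal.ofReal_rpow_of_pos hm0]
  exact ENNReal.ofReal_ne_top

/-- Under the diagonal coupling the two displacements differ by the constant y - x, so the Minkowski
error is exactly m^(1/p) times the distance. -/
theorem dtm_le_add_dist [IsProbabilityMeasure μ] (hm0 : 0 < m) (hm1 : m ≤ 1) (hp : 1 ≤ p)
    (hb : ∀ x, ∃ D, 0 < D ∧ μ (Metric.ball x D) = 1) :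
    dtm m p μ x ≤ dtm m p μ y + dist x y := by
  have hp0 : 0 < p := by linarith
  obtain ⟨D, hD0, hD⟩ := hb x
  obtain ⟨D', hD0', hD'⟩ := hb y
  have hmd : Measurable fun z : EuclideanSpace ℝ (Fin d) => (z, z) := by fun_prop
  obtain ⟨σ, -, hσm, hσ, hle⟩ := pseudoDTMIntegral_rpow_le_of_coupling (x := x) (y := y)
    (π := μ.map fun z => (z, z)) hm1 hp hD0 hD hD0' hD'
    (by rw [Measure.fst, Measure.map_map measurable_fst hmd]; exact Measure.map_id)
    (by rw [Measure.snd, Measure.map_map measurable_snd hmd]; exact Measure.map_id)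
  have hae : ∀ᵐ z ∂σ, z.1 = z.2 := by
    have h1 : ∀ᵐ z ∂(μ.map fun z => (z, z)), z.1 = z.2 :=
      (ae_map_iff hmd.aemeasurable (measurableSet_eq_fun measurable_fst measurable_snd)).2
        (Filter.Eventually.of_forall fun _ => rfl)
    exact hσ.ae_le h1
  have hint : ∫⁻ z, ‖(z.1 - x) - (z.2 - y)‖ₑ ^ p ∂σ =
      ENNReal.ofReal (dist x y) ^ p * ENNReal.ofReal m := by
    rw [lintegral_congr_ae (g := fun _ => ENNReal.ofReal (dist x y) ^ p)]
    · rw [lintegral_const, hσm]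
    · filter_upwards [hae] with z hz
      rw [hz, sub_sub_sub_cancel_left, dist_comm, dist_eq_norm, ofReal_norm]
  rw [hint, ENNReal.mul_rpow_of_nonneg _ _ (by positivity), ← ENNReal.rpow_mul,
    mul_one_div_cancel hp0.ne', ENNReal.rpow_one, ← ofReal_dtm_mul hm0 hm1 hp0 hD0 hD,
    ← ofReal_dtm_mul hm0 hm1 hp0 hD0' hD', ← add_mul,
    ENNReal.mul_le_mul_iff_left (ofReal_rpow_ne_zero hm0 _) (ofReal_rpow_ne_top hm0 _),
    ← ENNReal.ofReal_add (dtm_nonneg hm0) dist_nonneg,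
    ENNReal.ofReal_le_ofReal_iff (add_nonneg (dtm_nonneg hm0) dist_nonneg)] at hle
  exact hle

/-- The distance to the measure at `x` being small forces balls around `x` to have a large mass. -/
theorem le_measure_ball_of_dtm_le (hm0 : 0 < m) (hm1 : m ≤ 1) (hp : 1 ≤ p)
    (hb : ∀ x, ∃ D, 0 < D ∧ μ (Metric.ball x D) = 1) {r r' : ℝ} (hr : 0 < r)
    (hle : dtm m p μ x ≤ r) (hrr' : 2 * r < r') :
    ENNReal.ofReal (m / 2) ≤ μ (Metric.ball x r') := by
  have hp0 : 0 < p := by linarith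
  obtain ⟨D, hD0, hD⟩ := hb x
  by_contra hcon
  rw [not_le] at hcon
  -- Markov's inequality: a ball of mass below m/2 would make the pseudo distance at least r' for
  -- all u in (m/2, m), so r'^p / 2 ≤ r^p, against r' > 2r and 2^p ≥ 2.
  have h1 : ENNReal.ofReal (r' ^ p) * ENNReal.ofReal (m / 2) ≤ pseudoDTMIntegral m p μ x := by
    calc ENNReal.ofReal (r' ^ p) * ENNReal.ofReal (m / 2)
        = ∫⁻ _ in Ioo (m / 2) m, ENNReal.ofReal (r' ^ p) := by
          rw [setLIntegral_const, Real.volume_Ioo, sub_half]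
      _ ≤ ∫⁻ u in Ioo (m / 2) m, ENNReal.ofReal (pseudoDTM μ u x ^ p) := by
          refine setLIntegral_mono' measurableSet_Ioo fun u hu => ENNReal.ofReal_le_ofReal ?_
          refine Real.rpow_le_rpow (by linarith) ?_ hp0.le
          rw [le_pseudoDTM_iff hD0
            (ofReal_lt_measure_ball hm1 hD ⟨(half_pos hm0).trans hu.1, hu.2⟩)]
          exact hcon.le.trans (ENNReal.ofReal_le_ofReal hu.1.le)
      _ ≤ pseudoDTMIntegral m p μ x :=
          lintegral_mono_set (Ioo_subset_Ioo_left (half_pos hm0).le)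
  have h2 : pseudoDTMIntegral m p μ x ≤ ENNReal.ofReal (r ^ p) * ENNReal.ofReal m := by
    have h3 := ofReal_dtm_mul (x := x) hm0 hm1 hp0 hD0 hD
    have h4 : (pseudoDTMIntegral m p μ x ^ (1 / p)) ^ p = pseudoDTMIntegral m p μ x := by
      rw [← ENNReal.rpow_mul, one_div_mul_cancel hp0.ne', ENNReal.rpow_one]
    rw [← h4, ← h3, ENNReal.mul_rpow_of_nonneg _ _ hp0.le, ← ENNReal.rpow_mul,
      one_div_mul_cancel hp0.ne', ENNReal.rpow_one,
      ENNReal.ofReal_rpow_of_nonneg (dtm_nonneg hm0) hp0.le]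
    gcongr
    exact dtm_nonneg hm0
  have h5 := h1.trans h2
  have hr' : 0 < r' := by linarith
  rw [← ENNReal.ofReal_mul (by positivity), ← ENNReal.ofReal_mul (by positivity),
    ENNReal.ofReal_le_ofReal_iff (by positivity)] at h5
  have h6 : (2 * r) ^ p < r' ^ p := Real.rpow_lt_rpow (by positivity) hrr' hp0
  rw [Real.mul_rpow zero_le_two hr.le] at h6
  have h7 : (2 : ℝ) ≤ 2 ^ p := by
    simpa using Real.rpow_le_rpow_of_exponent_le one_le_two hp
  have h8 : 0 < r ^ p := by positivity
  have h9 : r' ^ p / 2 ≤ r ^ p := le_of_mul_le_mul_right (by linarith) hm0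
  linarith [mul_le_mul_of_nonneg_right h7 h8.le]

/-- The centres form a 5r-separated subset of the sublevel set of maximal cardinality, and
maximality makes it a cover. Balls of radius 5r/2 > 2r around its points are disjoint and have mass
at least m/2 each, hence the count 2/m. -/
theorem isCoverable_dtm [IsProbabilityMeasure μ] (hm0 : 0 < m) (hm1 : m ≤ 1) (hp : 1 ≤ p)
    (hb : ∀ x, ∃ D, 0 < D ∧ μ (Metric.ball x D) = 1) : IsCoverable (dtm m p μ) (2 / m) := by
  refine ⟨?_, fun _ => dtm_nonneg hm0, fun r hr => ?_⟩
  · refine LipschitzWith.of_le_add fun a b => ?_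
    exact dtm_le_add_dist hm0 hm1 hp hb
  classical
  let P : Finset (EuclideanSpace ℝ (Fin d)) → Prop := fun T =>
    (∀ z ∈ T, dtm m p μ z ≤ r) ∧ ∀ z ∈ T, ∀ w ∈ T, z ≠ w → 5 * r < dist z w
  have hcard : ∀ T, P T → (T.card : ℝ) ≤ 2 / m := by
    intro T hT
    have hdisj : (T : Set (EuclideanSpace ℝ (Fin d))).PairwiseDisjoint
        fun z => Metric.ball z (5 / 2 * r) := fun z hz w hw hne =>
      Metric.ball_disjoint_ball (by linarith [hT.2 z hz w hw hne])
    have h1 : (T.card : ℝ≥0∞) * ENNReal.ofReal (m / 2) ≤ 1 := by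
      calc (T.card : ℝ≥0∞) * ENNReal.ofReal (m / 2)
          = ∑ _z ∈ T, ENNReal.ofReal (m / 2) := by simp
        _ ≤ ∑ z ∈ T, μ (Metric.ball z (5 / 2 * r)) := Finset.sum_le_sum fun z hz =>
            le_measure_ball_of_dtm_le hm0 hm1 hp hb hr (hT.1 z hz) (by linarith)
        _ = μ (⋃ z ∈ T, Metric.ball z (5 / 2 * r)) :=
            (measure_biUnion_finset hdisj fun _ _ => measurableSet_ball).symm
        _ ≤ 1 := prob_le_one
    rw [← ENNReal.ofReal_natCast, ← ENNReal.ofReal_mul (Nat.cast_nonneg _),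
      ENNReal.ofReal_le_one] at h1
    rw [le_div_iff₀ hm0]
    linarith
  have hbdd : ∀ n ∈ {n : ℕ | ∃ T, P T ∧ T.card = n}, n ≤ ⌊2 / m⌋₊ := by
    rintro n ⟨T, hT, rfl⟩
    exact Nat.le_floor (hcard T hT)
  obtain ⟨T, hT, hTc⟩ := Nat.sSup_mem (s := {n : ℕ | ∃ T, P T ∧ T.card = n})
    ⟨0, ∅, ⟨by simp, by simp⟩, rfl⟩ ⟨_, hbdd⟩
  refine ⟨T, hcard T hT, fun z hz => ?_⟩
  by_contra! hcon
  have hzT : z ∉ T := fun h => by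
    have := hcon z h
    rw [dist_self] at this
    linarith
  have hP : P (insert z T) := by
    refine ⟨fun w hw => ?_, fun w hw w' hw' hne => ?_⟩
    · rcases Finset.mem_insert.1 hw with rfl | hw
      · exact hz
      · exact hT.1 w hw
    · rcases Finset.mem_insert.1 hw with rfl | hwT
      · rcases Finset.mem_insert.1 hw' with rfl | hwT'
        · exact absurd rfl hne
        · exact hcon _ hwT'
      · rcases Finset.mem_insert.1 hw' with rfl | hwT'
        · rw [dist_comm]; exact hcon _ hwT
        · exact hT.2 w hwT w' hwT' hne
  have := le_csSup ⟨_, hbdd⟩ ⟨insert z T, hP, rfl⟩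
  rw [← hTc, Finset.card_insert_of_notMem hzT] at this
  omega

theorem isCoverable_max_const {f : EuclideanSpace ℝ (Fin d) → ℝ} {N : ℝ} (hf : IsCoverable f N)
    (δ : ℝ) : IsCoverable (fun z => max (f z) δ) N := by
  refine ⟨by simpa using hf.lipschitz.max_const δ, fun z => (hf.nonneg z).trans (le_max_left _ _),
    fun r hr => ?_⟩
  obtain ⟨T, hT, h⟩ := hf.cover r hr
  exact ⟨T, hT, fun z hz => h z ((le_max_left _ _).trans hz)⟩

/-- A probability measure with bounded support gives full mass to large balls. -/
theorem exists_ball_measure_eq_one [IsProbabilityMeasure μ] {K : Set (EuclideanSpace ℝ (Fin d))}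
    (hK : Bornology.IsBounded K) (hμ : μ.support ⊆ K) (x : EuclideanSpace ℝ (Fin d)) :
    ∃ D, 0 < D ∧ μ (Metric.ball x D) = 1 := by
  obtain ⟨D, hD0, hD⟩ := hK.subset_ball_lt 0 x
  refine ⟨D, hD0, (prob_compl_eq_zero_iff measurableSet_ball).1 ?_⟩
  exact measure_mono_null (compl_subset_compl.2 (hμ.trans hD)) Measure.measure_compl_support

/-- Every open ball of radius D > diam K around x contains the support; radius diam K itself might
miss boundary points, hence the limit in D. -/
theorem dtm_le_diam [IsProbabilityMeasure μ] {K : Set (EuclideanSpace ℝ (Fin d))}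
    (hm0 : 0 < m) (hm1 : m ≤ 1) (hp : 1 ≤ p)
    (hK : Bornology.IsBounded K) (hμ : μ.support ⊆ K) (hx : x ∈ K) :
    dtm m p μ x ≤ Metric.diam K := by
  have hp0 : 0 < p := by linarith
  refine le_of_forall_gt_imp_ge_of_dense fun D hD => ?_
  have hD0 : 0 < D := Metric.diam_nonneg.trans_lt hD
  have hball : μ (Metric.ball x D) = 1 := by
    refine (prob_compl_eq_zero_iff measurableSet_ball).1 ?_
    refine measure_mono_null (compl_subset_compl.2 (hμ.trans fun z hz => ?_))
      Measure.measure_compl_support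
    exact (Metric.dist_le_diam_of_mem hK hz hx).trans_lt hD
  have h1 := ofReal_dtm_mul (x := x) hm0 hm1 hp0 hD0 hball
  have h2 := pseudoDTMIntegral_le_of_ball hm1 hp0 hD0 hball
  have h3 : ENNReal.ofReal (dtm m p μ x) * ENNReal.ofReal m ^ (1 / p) ≤
      ENNReal.ofReal D * ENNReal.ofReal m ^ (1 / p) := by
    rw [h1]
    refine (ENNReal.rpow_le_rpow h2 (by positivity)).trans_eq ?_
    rw [ENNReal.mul_rpow_of_nonneg _ _ (by positivity),
      ← ENNReal.ofReal_rpow_of_nonneg hD0.le hp0.le, ← ENNReal.rpow_mul,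
      mul_one_div_cancel hp0.ne', ENNReal.rpow_one]
  rwa [ENNReal.mul_le_mul_iff_left (ofReal_rpow_ne_zero hm0 _) (ofReal_rpow_ne_top hm0 _),
    ENNReal.ofReal_le_ofReal_iff hD0.le] at h3

theorem ofReal_dtm_sub_mul_le_wasserstein [IsProbabilityMeasure μ] [IsProbabilityMeasure ν]
    (hm0 : 0 < m) (hm1 : m ≤ 1) (hp : 1 ≤ p)
    (hbμ : ∀ x, ∃ D, 0 < D ∧ μ (Metric.ball x D) = 1)
    (hbν : ∀ x, ∃ D, 0 < D ∧ ν (Metric.ball x D) = 1) (x : EuclideanSpace ℝ (Fin d))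
    {π : Measure (EuclideanSpace ℝ (Fin d) × EuclideanSpace ℝ (Fin d))}
    (h1 : π.fst = μ) (h2 : π.snd = ν) :
    ENNReal.ofReal (dtm m p μ x - dtm m p ν x) * ENNReal.ofReal m ^ (1 / p) ≤
      (∫⁻ z, ‖z.1 - z.2‖ₑ ^ p ∂π) ^ (1 / p) := by
  have hp0 : 0 < p := by linarith
  obtain ⟨D, hD0, hD⟩ := hbμ x
  obtain ⟨D', hD0', hD'⟩ := hbν x
  obtain ⟨σ, hσ, -, -, hle⟩ := pseudoDTMIntegral_rpow_le_of_coupling (x := x) (y := x)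
    hm1 hp hD0 hD hD0' hD' h1 h2
  rw [← ofReal_dtm_mul hm0 hm1 hp0 hD0 hD, ← ofReal_dtm_mul hm0 hm1 hp0 hD0' hD'] at hle
  rw [ENNReal.ofReal_sub _ (dtm_nonneg hm0), ENNReal.sub_mul fun _ _ => ofReal_rpow_ne_top hm0 _,
    tsub_le_iff_left]
  refine hle.trans ?_
  gcongr with z
  rw [sub_sub_sub_cancel_right]

theorem enorm_dtm_sub_mul_le_wasserstein [IsProbabilityMeasure μ] [IsProbabilityMeasure ν]
    (hm0 : 0 < m) (hm1 : m ≤ 1) (hp : 1 ≤ p)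
    (hbμ : ∀ x, ∃ D, 0 < D ∧ μ (Metric.ball x D) = 1)
    (hbν : ∀ x, ∃ D, 0 < D ∧ ν (Metric.ball x D) = 1) (x : EuclideanSpace ℝ (Fin d)) :
    ‖dtm m p μ x - dtm m p ν x‖ₑ * ENNReal.ofReal m ^ (1 / p) ≤ wasserstein p μ ν := by
  refine le_iInf₂ fun π hπ => ?_
  obtain ⟨-, h1, h2⟩ := hπ
  rw [← ofReal_norm, Real.norm_eq_abs]
  rcases le_total (dtm m p ν x) (dtm m p μ x) with h | h
  · rw [abs_of_nonneg (sub_nonneg.2 h)]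
    exact ofReal_dtm_sub_mul_le_wasserstein hm0 hm1 hp hbμ hbν x h1 h2
  · rw [abs_sub_comm, abs_of_nonneg (sub_nonneg.2 h)]
    have hsw : Measurable (Prod.swap :
      EuclideanSpace ℝ (Fin d) × EuclideanSpace ℝ (Fin d) → _) := measurable_swap
    refine (ofReal_dtm_sub_mul_le_wasserstein (π := π.map Prod.swap) hm0 hm1 hp hbν hbμ x ?_
      ?_).trans_eq ?_
    · rw [Measure.fst_map_swap, h2]
    · rw [Measure.snd_map_swap, h1]
    · rw [lintegral_map (by fun_prop) hsw]
      simp only [Prod.fst_swap, Prod.snd_swap]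
      congr 2 with z
      rw [← enorm_neg, neg_sub]

theorem abs_rpow_sub_rpow_le {a b D β : ℝ} (hβ : 1 ≤ β) (ha : a ∈ Icc 0 D) (hb : b ∈ Icc 0 D) :
    |a ^ β - b ^ β| ≤ β * D ^ (β - 1) * |a - b| := by
  refine Convex.norm_image_sub_le_of_norm_hasDerivWithin_le (s := Icc 0 D)
    (f' := fun z => β * z ^ (β - 1))
    (fun z _ => (Real.hasDerivAt_rpow_const (Or.inr hβ)).hasDerivWithinAt) (fun z hz => ?_)
    (convex_Icc 0 D) hb ha
  rw [Real.norm_of_nonneg (mul_nonneg (by linarith) (Real.rpow_nonneg hz.1 _))]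
  exact mul_le_mul_of_nonneg_left (Real.rpow_le_rpow hz.1 hz.2 (by linarith)) (by linarith)

theorem ofReal_mul_supNormOn_le_wasserstein [IsProbabilityMeasure μ] [IsProbabilityMeasure ν]
    {K : Set (EuclideanSpace ℝ (Fin d))} {β l : ℝ} (hl : 0 ≤ l)
    (hm0 : 0 < m) (hm1 : m ≤ 1) (hp : 1 ≤ p) (hβ : 1 ≤ β)
    (hK : Bornology.IsBounded K) (hμ : μ.support ⊆ K) (hν : ν.support ⊆ K) :
    ENNReal.ofReal (l * Metric.diam K) *
        supNormOn K (fun x => dtm m p μ x ^ β - dtm m p ν x ^ β) ≤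
      ENNReal.ofReal (β * l / m ^ (1 / p) * Metric.diam K ^ β) * wasserstein p μ ν := by
  have hD0 : 0 ≤ Metric.diam K := Metric.diam_nonneg
  set D := Metric.diam K with hD
  -- The identity survives D = 0, where `D ^ (β - 1)` may be 1 or 0.
  have hdiam : D * D ^ (β - 1) = D ^ β := by
    rcases hD0.eq_or_lt with h | h
    · rw [← h, zero_mul, Real.zero_rpow (by linarith)]
    · rw [Real.rpow_sub_one h.ne']; field_simp
  have hM : ENNReal.ofReal m ^ (1 / p) = ENNReal.ofReal (m ^ (1 / p)) :=
    ENNReal.ofReal_rpow_of_pos hm0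
  unfold supNormOn
  simp_rw [ENNReal.mul_iSup]
  refine iSup₂_le fun x hx => ?_
  have h1 := enorm_dtm_sub_mul_le_wasserstein (p := p) hm0 hm1 hp
    (exists_ball_measure_eq_one hK hμ) (exists_ball_measure_eq_one hK hν) x
  have h2 := abs_rpow_sub_rpow_le (D := D) hβ
    ⟨dtm_nonneg hm0, dtm_le_diam (p := p) hm0 hm1 hp hK hμ hx⟩
    ⟨dtm_nonneg hm0, dtm_le_diam (p := p) hm0 hm1 hp hK hν hx⟩
  have hpos : 0 < m ^ (1 / p) := by positivity
  calc ENNReal.ofReal (l * D) * ‖dtm m p μ x ^ β - dtm m p ν x ^ β‖ₑ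
      ≤ ENNReal.ofReal (l * D) *
        (ENNReal.ofReal (β * D ^ (β - 1)) * ‖dtm m p μ x - dtm m p ν x‖ₑ) := by
        gcongr
        rw [← ofReal_norm, ← ofReal_norm, ← ENNReal.ofReal_mul (by positivity)]
        exact ENNReal.ofReal_le_ofReal h2
    _ = ENNReal.ofReal (β * l / m ^ (1 / p) * D ^ β) *
        (‖dtm m p μ x - dtm m p ν x‖ₑ * ENNReal.ofReal m ^ (1 / p)) := by
        rw [hM, ← mul_assoc, ← ENNReal.ofReal_mul (by positivity), mul_comm ‖_‖ₑ,
          ← mul_assoc (ENNReal.ofReal (β * l / _ * _)), ← ENNReal.ofReal_mul (by positivity),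
          ← hdiam]
        congr 2
        field_simp
    _ ≤ _ := by gcongr

end DTMEstimates

/-! ### Length of geodesics and stability of the Fermat distance -/

section Geodesics

variable {d : ℕ} {μ ν : Measure (EuclideanSpace ℝ (Fin d))} {x y : EuclideanSpace ℝ (Fin d)}
  {F K : Set (EuclideanSpace ℝ (Fin d))} {γ : ℝ → EuclideanSpace ℝ (Fin d)} {m p β : ℝ}

/-- With N = 2/m the left side is 800/m² · (4160/m²)^β. Of c only the term with 165^β is kept; since
ρ^(β+1)/(ρ - 1) ≥ (32/m)^β and 165 · 32 = 5280, λ is at least 2304/m² · (5280/m²)^β. The leading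
factor 2 is the room used for almost minimizers. -/
theorem two_mul_le_geodesicConst (hm0 : 0 < m) (hβ : 1 ≤ β) :
    2 * (100 * (2 / m) ^ 2 * (1040 * (2 / m) ^ 2) ^ β) ≤ geodesicConst m β := by
  have hβ0 : 0 ≤ β := by linarith
  have hmβ : 0 < m ^ (2 + β) := by positivity
  have hρ : 32 / m ≤ geodesicRho m := by unfold geodesicRho; linarith
  have h32 : 0 < 32 / m := by positivity
  have hρ0 : 0 < geodesicRho m := h32.trans_le hρ
  have hρ1 : geodesicRho m - 1 = 32 / m := by unfold geodesicRho; ring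
  have h1 : (32 / m) ^ β ≤ geodesicRho m ^ (β + 1) / (geodesicRho m - 1) := by
    rw [hρ1, le_div_iff₀ h32, Real.rpow_add_one hρ0.ne']
    gcongr
  have h2 : 1152 * (165 : ℝ) ^ β / m ^ (2 + β) ≤ geodesicC m β := by
    unfold geodesicC
    gcongr
    have : (0 : ℝ) ≤ 16 * 5 ^ β := by positivity
    linarith
  have h3 : 1152 * (165 : ℝ) ^ β / m ^ (2 + β) * (32 / m) ^ β =
      1152 / m ^ 2 * (5280 / m ^ 2) ^ β := by
    have e1 : m ^ (2 + β) = m ^ 2 * m ^ β := by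
      rw [Real.rpow_add hm0, Real.rpow_ofNat]
    have e2 : (5280 / m ^ 2 : ℝ) = 165 / m * (32 / m) := by field_simp; norm_num
    rw [e1, e2, Real.mul_rpow (x := 165 / m) (by positivity) (by positivity),
      Real.div_rpow (x := 165) (y := m) (by norm_num) hm0.le]
    field_simp
  have h4 : 2 * (100 * (2 / m) ^ 2 * (1040 * (2 / m) ^ 2) ^ β) =
      800 / m ^ 2 * (4160 / m ^ 2) ^ β := by
    have e3 : (1040 * (2 / m) ^ 2 : ℝ) = 4160 / m ^ 2 := by field_simp; norm_num
    rw [e3]; field_simp; norm_num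
  have h5 : (4160 / m ^ 2 : ℝ) ^ β ≤ (5280 / m ^ 2) ^ β := by
    refine Real.rpow_le_rpow (by positivity) ?_ hβ0
    gcongr
    norm_num
  have h6 : 0 < (5280 / m ^ 2 : ℝ) ^ β := by positivity
  rw [h4]
  unfold geodesicConst
  calc 800 / m ^ 2 * (4160 / m ^ 2) ^ β ≤ 2 * (1152 / m ^ 2 * (5280 / m ^ 2) ^ β) := by
        rw [← mul_assoc, ← mul_div_assoc]
        gcongr
        norm_num
    _ = 2 * (1152 * (165 : ℝ) ^ β / m ^ (2 + β) * (32 / m) ^ β) := by rw [h3]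
    _ ≤ 2 * (geodesicC m β * (geodesicRho m ^ (β + 1) / (geodesicRho m - 1))) := by
        have : 0 ≤ (32 / m) ^ β := by positivity
        have : 0 ≤ geodesicC m β := le_trans (by positivity) h2
        gcongr
    _ = _ := by ring

theorem geodesicConst_pos (hm0 : 0 < m) (hβ : 1 ≤ β) : 0 < geodesicConst m β :=
  lt_of_lt_of_le (by positivity) (two_mul_le_geodesicConst hm0 hβ)

theorem IsAdmissible.pathLength_ne_top (h : IsAdmissible F x y γ) : pathLength γ ≠ ∞ :=
  (ac_lintegral_deriv_lt_top zero_le_one h.rectifiable).ne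

theorem IsAdmissible.weightedLength_ne_top {f : EuclideanSpace ℝ (Fin d) → ℝ} {N : ℝ}
    (hf : IsCoverable f N) (hβ : 0 ≤ β) (h : IsAdmissible F x y γ) :
    weightedLength f β γ (Icc 0 1) ≠ ∞ := by
  obtain ⟨C, hC⟩ := isCompact_Icc.exists_bound_of_continuousOn
    (hf.lipschitz.continuous.comp_continuousOn h.continuousOn)
  refine ne_top_of_le_ne_top
    (ENNReal.mul_ne_top (ENNReal.ofReal_ne_top (r := C ^ β)) h.pathLength_ne_top) ?_
  unfold weightedLength pathLength
  rw [← lintegral_const_mul' _ _ ENNReal.ofReal_ne_top]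
  refine setLIntegral_mono' measurableSet_Icc fun t ht => ?_
  gcongr
  · exact hf.nonneg _
  · exact (le_abs_self _).trans (hC t ht)

theorem ofReal_fdtmLength {N : ℝ} (hf : IsCoverable (dtm m p μ) N) (hβ : 0 ≤ β)
    (h : IsAdmissible F x y γ) :
    ENNReal.ofReal (fdtmLength m p β μ γ) = weightedLength (dtm m p μ) β γ (Icc 0 1) := by
  have hcont : ContinuousOn (fun t => dtm m p μ (γ t) ^ β) (Icc 0 1) :=
    (hf.lipschitz.continuous.comp_continuousOn h.continuousOn).rpow_const fun _ _ => Or.inr hβ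
  have hint : IntegrableOn (fun t => dtm m p μ (γ t) ^ β * ‖deriv γ t‖) (Icc 0 1) := by
    have h1 := ((intervalIntegrable_iff_integrableOn_Icc_of_le zero_le_one).1
      (ac_intervalIntegrable_deriv h.rectifiable)).norm
    exact IntegrableOn.continuousOn_mul hcont h1 isCompact_Icc
  unfold fdtmLength weightedLength
  rw [intervalIntegral.integral_of_le zero_le_one, ← integral_Icc_eq_integral_Ioc,
    ofReal_integral_eq_lintegral_ofReal hint (Filter.Eventually.of_forall fun t =>
      mul_nonneg (Real.rpow_nonneg (hf.nonneg _) _) (norm_nonneg _))]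
  refine lintegral_congr fun t => ?_
  rw [ENNReal.ofReal_mul (Real.rpow_nonneg (hf.nonneg _) _), ofReal_norm]

theorem fdtmLength_nonneg (hm0 : 0 < m) : 0 ≤ fdtmLength m p β μ γ :=
  intervalIntegral.integral_nonneg zero_le_one fun _ _ =>
    mul_nonneg (Real.rpow_nonneg (dtm_nonneg hm0) _) (norm_nonneg _)

theorem fdtm_nonneg (hm0 : 0 < m) : 0 ≤ fdtm m p β μ F x y := by
  refine Real.sInf_nonneg ?_
  rintro _ ⟨γ, -, rfl⟩
  exact fdtmLength_nonneg hm0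

theorem fdtm_le_fdtmLength (hm0 : 0 < m) (h : IsAdmissible F x y γ) :
    fdtm m p β μ F x y ≤ fdtmLength m p β μ γ := by
  refine csInf_le ⟨0, ?_⟩ ⟨γ, h, rfl⟩
  rintro _ ⟨γ, -, rfl⟩
  exact fdtmLength_nonneg hm0

theorem ofReal_le_supNormOn {α : Type*} {s : Set α} {f : α → ℝ} {z : α} (hz : z ∈ s) :
    ENNReal.ofReal (f z) ≤ supNormOn s f := by
  refine le_trans ?_ (le_iSup₂ (f := fun x _ => ‖f x‖ₑ) z hz)
  rw [← ofReal_norm]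
  exact ENNReal.ofReal_le_ofReal (Real.le_norm_self _)

/-- The length of a geodesic is controlled by the maximum along it of the distance to the
measure. -/
theorem IsGeodesic.pathLength_le [IsProbabilityMeasure μ] (hm0 : 0 < m) (hm1 : m ≤ 1)
    (hp : 1 ≤ p) (hβ : 1 ≤ β) (hF : IsClosed F)
    (hb : ∀ x, ∃ D, 0 < D ∧ μ (Metric.ball x D) = 1) (h : IsGeodesic m p β μ F x y γ) :
    pathLength γ ≤ ENNReal.ofReal (geodesicConst m β) *
      supNormOn (γ '' Icc 0 1) (dtm m p μ) := by
  obtain ⟨hγ, hmin⟩ := h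
  have hβ0 : 0 ≤ β := by linarith
  have hf := isCoverable_dtm (p := p) hm0 hm1 hp hb
  obtain ⟨t₀, ht₀, hmax⟩ := isCompact_Icc.exists_isMaxOn (nonempty_Icc.2 zero_le_one)
    (hf.lipschitz.continuous.comp_continuousOn hγ.continuousOn)
  have hle : ∀ t ∈ Icc (0 : ℝ) 1, dtm m p μ (γ t) ≤ dtm m p μ (γ t₀) := fun t ht => hmax ht
  -- If the maximum is 0, the path stays in the finite zero set and has length 0; the dyadic
  -- argument needs a positive R.
  rcases (hf.nonneg (γ t₀)).eq_or_lt with h0 | h0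
  · have : pathLength γ = 0 :=
      lintegral_enorm_deriv_eq_zero_of_mapsTo_finite measurableSet_Icc hf.finite_zeros
        fun t ht => le_antisymm ((hle t ht).trans_eq h0.symm) (hf.nonneg _)
    rw [this]; exact bot_le
  · have hN : 2 ≤ 2 / m := by rw [le_div_iff₀ hm0]; linarith
    have h1 := lintegral_deriv_le_of_minimizing hf hN hβ0 hF hγ
      (hγ.weightedLength_ne_top hf hβ0) (fun γ' h' => by
        rw [← ofReal_fdtmLength hf hβ0 hγ, ← ofReal_fdtmLength hf hβ0 h', hmin]
        exact ENNReal.ofReal_le_ofReal (fdtm_le_fdtmLength hm0 h')) h0 hle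
    refine h1.trans ?_
    rw [ENNReal.ofReal_mul (by positivity)]
    have h2 := two_mul_le_geodesicConst hm0 hβ
    have h3 : 0 ≤ 100 * (2 / m) ^ 2 * (1040 * (2 / m) ^ 2) ^ β := by positivity
    gcongr
    · linarith
    · exact ofReal_le_supNormOn (mem_image_of_mem γ ht₀)

theorem max_rpow_le_add {a δ : ℝ} (hδ0 : 0 ≤ δ) (hδ1 : δ ≤ 1) (hβ : 1 ≤ β) (ha : 0 ≤ a) :
    max a δ ^ β ≤ a ^ β + δ := by
  rcases le_total δ a with h | h
  · rw [max_eq_left h]; linarith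
  · rw [max_eq_right h]
    have h1 : δ ^ β ≤ δ ^ (1 : ℝ) := by
      rcases hδ0.eq_or_lt with rfl | h0
      · rw [Real.zero_rpow (by linarith), Real.rpow_one]
      · exact Real.rpow_le_rpow_of_exponent_ge h0 hδ1 hβ
    rw [Real.rpow_one] at h1
    linarith [Real.rpow_nonneg ha β]

theorem weightedLength_mono_weight {f g : EuclideanSpace ℝ (Fin d) → ℝ} {S : Set ℝ} (hβ : 0 ≤ β)
    (hf : ∀ z, 0 ≤ f z) (h : ∀ z, f z ≤ g z) :
    weightedLength f β γ S ≤ weightedLength g β γ S := by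
  unfold weightedLength
  gcongr with t
  · exact hf _
  · exact h _

theorem weightedLength_le_add_mul_pathLength {f g : EuclideanSpace ℝ (Fin d) → ℝ} {c : ℝ}
    (hf : ∀ z, 0 ≤ f z)
    (h : ∀ t ∈ Icc (0 : ℝ) 1, g (γ t) ^ β ≤ f (γ t) ^ β + c) (hc : 0 ≤ c) :
    weightedLength g β γ (Icc 0 1) ≤
      weightedLength f β γ (Icc 0 1) + ENNReal.ofReal c * pathLength γ := by
  unfold weightedLength pathLength
  have hm : Measurable fun t : ℝ => ENNReal.ofReal c * ‖deriv γ t‖ₑ :=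
    ((measurable_deriv γ).enorm).const_mul _
  rw [← lintegral_const_mul' _ _ ENNReal.ofReal_ne_top, ← lintegral_add_right _ hm]
  refine setLIntegral_mono' measurableSet_Icc fun t ht => ?_
  rw [← add_mul, ← ENNReal.ofReal_add (Real.rpow_nonneg (hf _) _) hc]
  gcongr
  exact h t ht

/-- There are almost minimizing paths whose length satisfies the same bound as geodesics. -/
theorem exists_almost_minimizing [IsProbabilityMeasure μ] (hm0 : 0 < m) (hm1 : m ≤ 1)
    (hp : 1 ≤ p) (hβ : 1 ≤ β) (hK : Bornology.IsBounded K) (hKc : Convex ℝ K)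
    (hF : IsClosed F) (hFK : F ⊆ K) (hμ : μ.support ⊆ K)
    (hu : ∃ u : EuclideanSpace ℝ (Fin d), ‖u‖ = 1) (hx : x ∈ K) (hy : y ∈ K)
    (hD : 0 < Metric.diam K) {η : ℝ} (hη : 0 < η) :
    ∃ γ, IsAdmissible F x y γ ∧ fdtmLength m p β μ γ ≤ fdtm m p β μ F x y + η ∧
      pathLength γ ≤ ENNReal.ofReal (geodesicConst m β * Metric.diam K) := by
  set R := Metric.diam K with hR
  have hβ0 : 0 ≤ β := by linarith
  have hf := isCoverable_dtm (p := p) hm0 hm1 hp (exists_ball_measure_eq_one hK hμ)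
  have hN : 2 ≤ 2 / m := by rw [le_div_iff₀ hm0]; linarith
  obtain ⟨_, ⟨γ₀, hγ₀, rfl⟩, hlt⟩ := exists_lt_of_csInf_lt
    (⟨_, _, isAdmissible_segment hu, rfl⟩ :
      (fdtmLength m p β μ '' {γ | IsAdmissible F x y γ}).Nonempty)
    (lt_add_of_pos_right (fdtm m p β μ F x y) (by positivity : 0 < η / 4))
  set l₀ := (pathLength γ₀).toReal with hl₀
  have hl₀' : pathLength γ₀ = ENNReal.ofReal l₀ :=
    (ENNReal.ofReal_toReal hγ₀.pathLength_ne_top).symm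
  have hl₀0 : 0 ≤ l₀ := ENNReal.toReal_nonneg
  -- The floor δ raises the cost of γ₀ by at most δ l₀ ≤ η/4. Here δ ≤ 1 gives δ^β ≤ δ, and δ ≤ R
  -- keeps the floored weight below R on K.
  set δ := min (min R 1) (η / 4 / (l₀ + 1)) with hδ
  have hδ0 : 0 < δ := lt_min (lt_min hD one_pos) (by positivity)
  have hδR : δ ≤ R := (min_le_left _ _).trans (min_le_left _ _)
  have hδ1 : δ ≤ 1 := (min_le_left _ _).trans (min_le_right _ _)
  have hδη : δ * l₀ ≤ η / 4 := by
    have h1 : δ ≤ η / 4 / (l₀ + 1) := min_le_right _ _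
    rw [le_div_iff₀ (by positivity)] at h1
    nlinarith
  set f : EuclideanSpace ℝ (Fin d) → ℝ := fun z => max (dtm m p μ z) δ with hfdef
  have hfc : IsCoverable f (2 / m) := isCoverable_max_const hf δ
  set A := 100 * (2 / m) ^ 2 * (1040 * (2 / m) ^ 2) ^ β with hA
  have hA0 : 0 < A := by positivity
  -- The allowed excess of length is A R, the same as the main term; their sum 2AR is at most λR.
  obtain ⟨ε₀, hε₀, H⟩ := exists_pos_lintegral_deriv_le (F := F) (x := x) (y := y) hfc hN hβ0 hF hD
    hδ0 (fun z => le_max_right _ _) (mul_pos hA0 hD)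
  set ε := min ε₀ (η / 4) with hε
  have hε0 : 0 < ε := lt_min hε₀ (by positivity)
  set I : ℝ≥0∞ := ⨅ γ, ⨅ _ : IsAdmissible F x y γ, weightedLength f β γ (Icc 0 1) with hI
  have hIle : ∀ γ, IsAdmissible F x y γ → I ≤ weightedLength f β γ (Icc 0 1) :=
    fun γ hγ => iInf₂_le γ hγ
  have hIfin : I ≠ ∞ := ne_top_of_le_ne_top (hγ₀.weightedLength_ne_top hfc hβ0) (hIle γ₀ hγ₀)
  obtain ⟨γ, hγ, hγI⟩ : ∃ γ, ∃ _ : IsAdmissible F x y γ,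
      weightedLength f β γ (Icc 0 1) < I + ENNReal.ofReal ε := by
    have := ENNReal.lt_add_right hIfin (ENNReal.ofReal_pos.2 hε0).ne'
    simpa only [hI, iInf_lt_iff] using this
  have hmem : ∀ t ∈ Icc (0 : ℝ) 1, γ t ∈ K := fun t ht =>
    hγ.mem_of_convex hKc hF hFK hx hy ht
  refine ⟨γ, hγ, ?_, ?_⟩
  · have h1 : weightedLength (dtm m p μ) β γ (Icc 0 1) ≤
        ENNReal.ofReal (fdtm m p β μ F x y + η) := by
      calc weightedLength (dtm m p μ) β γ (Icc 0 1)
          ≤ weightedLength f β γ (Icc 0 1) :=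
            weightedLength_mono_weight hβ0 hf.nonneg fun z => le_max_left _ _
        _ ≤ I + ENNReal.ofReal ε := hγI.le
        _ ≤ weightedLength f β γ₀ (Icc 0 1) + ENNReal.ofReal (η / 4) :=
            add_le_add (hIle γ₀ hγ₀) (ENNReal.ofReal_le_ofReal (min_le_right _ _))
        _ ≤ weightedLength (dtm m p μ) β γ₀ (Icc 0 1) + ENNReal.ofReal δ * pathLength γ₀ +
            ENNReal.ofReal (η / 4) := by
            gcongr
            exact weightedLength_le_add_mul_pathLength hf.nonneg
              (fun t _ => max_rpow_le_add hδ0.le hδ1 hβ (hf.nonneg _)) hδ0.le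
        _ = ENNReal.ofReal (fdtmLength m p β μ γ₀ + δ * l₀ + η / 4) := by
            have h2 : 0 ≤ fdtmLength m p β μ γ₀ := fdtmLength_nonneg hm0
            rw [← ofReal_fdtmLength hf hβ0 hγ₀, hl₀', ← ENNReal.ofReal_mul hδ0.le,
              ← ENNReal.ofReal_add h2 (by positivity),
              ← ENNReal.ofReal_add (by positivity) (by positivity)]
        _ ≤ _ := ENNReal.ofReal_le_ofReal (by linarith)
    rw [← ofReal_fdtmLength hf hβ0 hγ] at h1
    have h0 : 0 ≤ fdtm m p β μ F x y := fdtm_nonneg hm0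
    exact (ENNReal.ofReal_le_ofReal_iff (by positivity)).1 h1
  · refine (H ε (min_le_left _ _) γ hγ (hγ.weightedLength_ne_top hfc hβ0) (fun γ' h' => ?_)
      fun t ht => ?_).trans ?_
    · exact hγI.le.trans (add_le_add (hIle γ' h') le_rfl)
    · exact max_le (dtm_le_diam hm0 hm1 hp hK hμ (hmem t ht)) hδR
    · refine ENNReal.ofReal_le_ofReal ?_
      have := two_mul_le_geodesicConst hm0 hβ
      nlinarith

theorem fdtm_self (hm0 : 0 < m) (hu : ∃ u : EuclideanSpace ℝ (Fin d), ‖u‖ = 1) :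
    fdtm m p β μ F x x = 0 := by
  refine le_antisymm ((fdtm_le_fdtmLength hm0 (isAdmissible_segment hu)).trans_eq ?_)
    (fdtm_nonneg hm0)
  simp [fdtmLength]

/-- Comparison of the Fermat distances of two measures. -/
theorem fdtm_le_fdtm_add [IsProbabilityMeasure μ] [IsProbabilityMeasure ν] (hm0 : 0 < m)
    (hm1 : m ≤ 1) (hp : 1 ≤ p) (hβ : 1 ≤ β) (hK : Bornology.IsBounded K) (hKc : Convex ℝ K)
    (hF : IsClosed F) (hFK : F ⊆ K) (hμ : μ.support ⊆ K) (hν : ν.support ⊆ K)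
    (hu : ∃ u : EuclideanSpace ℝ (Fin d), ‖u‖ = 1) (hx : x ∈ K) (hy : y ∈ K) {B : ℝ} (hB0 : 0 ≤ B)
    (hB : ∀ z ∈ K, dtm m p ν z ^ β ≤ dtm m p μ z ^ β + B) :
    fdtm m p β ν F x y ≤ fdtm m p β μ F x y + geodesicConst m β * Metric.diam K * B := by
  have hβ0 : 0 ≤ β := by linarith
  have hc := geodesicConst_pos hm0 hβ
  have hfμ := isCoverable_dtm (p := p) hm0 hm1 hp (exists_ball_measure_eq_one hK hμ)
  have hfν := isCoverable_dtm (p := p) hm0 hm1 hp (exists_ball_measure_eq_one hK hν)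
  rcases (Metric.diam_nonneg (s := K)).eq_or_lt with hD | hD
  -- If diam K = 0 there is no positive scale R to start from, but then x = y and both distances
  -- vanish.
  · have hxy : x = y := by
      have := Metric.dist_le_diam_of_mem hK hx hy
      rw [← hD] at this
      exact dist_le_zero.1 this
    rw [hxy, fdtm_self hm0 hu, fdtm_self hm0 hu, ← hD]
    simp
  · refine le_of_forall_pos_le_add fun η hη => ?_
    obtain ⟨γ, hγ, hγη, hlen⟩ := exists_almost_minimizing hm0 hm1 hp hβ hK hKc hF hFK hμ hu hx hy
      hD hη
    have h0 : 0 ≤ fdtm m p β μ F x y := fdtm_nonneg hm0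
    refine (fdtm_le_fdtmLength hm0 hγ).trans ?_
    rw [← ENNReal.ofReal_le_ofReal_iff (by positivity), ofReal_fdtmLength hfν hβ0 hγ]
    calc weightedLength (dtm m p ν) β γ (Icc 0 1)
        ≤ weightedLength (dtm m p μ) β γ (Icc 0 1) + ENNReal.ofReal B * pathLength γ :=
          weightedLength_le_add_mul_pathLength hfμ.nonneg
            (fun t ht => hB _ (hγ.mem_of_convex hKc hF hFK hx hy ht)) hB0
      _ ≤ ENNReal.ofReal (fdtm m p β μ F x y + η) +
          ENNReal.ofReal B * ENNReal.ofReal (geodesicConst m β * Metric.diam K) := by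
          rw [← ofReal_fdtmLength hfμ hβ0 hγ]
          gcongr
      _ = ENNReal.ofReal (fdtm m p β μ F x y + geodesicConst m β * Metric.diam K * B + η) := by
          rw [← ENNReal.ofReal_mul hB0, ← ENNReal.ofReal_add (by positivity) (by positivity)]
          congr 1; ring

/-- Without unit vectors no path is admissible, and the real infimum of the empty set is 0 by
convention. The Fermat distances of μ and ν then agree trivially. -/
theorem fdtm_eq_zero_of_not_exists_unit
    (hu : ¬ ∃ u : EuclideanSpace ℝ (Fin d), ‖u‖ = 1) : fdtm m p β μ F x y = 0 := by
  have : {γ | IsAdmissible F x y γ} = ∅ :=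
    eq_empty_of_forall_notMem fun γ hγ => hu (IsAdmissible.exists_unit hγ)
  rw [fdtm, this, image_empty, Real.sInf_empty]

theorem supNormOn_fdtm_sub_le [IsProbabilityMeasure μ] [IsProbabilityMeasure ν] (hm0 : 0 < m)
    (hm1 : m ≤ 1) (hp : 1 ≤ p) (hβ : 1 ≤ β) (hK : Bornology.IsBounded K) (hKc : Convex ℝ K)
    (hF : IsClosed F) (hFK : F ⊆ K) (hμ : μ.support ⊆ K) (hν : ν.support ⊆ K) :
    supNormOn (K ×ˢ K) (fun z => fdtm m p β μ F z.1 z.2 - fdtm m p β ν F z.1 z.2) ≤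
      ENNReal.ofReal (geodesicConst m β * Metric.diam K) *
        supNormOn K (fun x => dtm m p μ x ^ β - dtm m p ν x ^ β) := by
  by_cases hu : ∃ u : EuclideanSpace ℝ (Fin d), ‖u‖ = 1
  swap
  · simp [supNormOn, fdtm_eq_zero_of_not_exists_unit hu]
  have hβ0 : 0 ≤ β := by linarith
  -- Finiteness lets the supremum be used as the real constant B of `fdtm_le_fdtm_add`.
  have hfin : supNormOn K (fun x => dtm m p μ x ^ β - dtm m p ν x ^ β) ≠ ∞ := by
    refine ne_top_of_le_ne_top (ENNReal.ofReal_ne_top (r := Metric.diam K ^ β)) ?_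
    refine iSup₂_le fun z hz => ?_
    rw [← ofReal_norm, Real.norm_eq_abs]
    refine ENNReal.ofReal_le_ofReal (abs_sub_le_of_nonneg_of_le ?_ ?_ ?_ ?_)
    · exact Real.rpow_nonneg (dtm_nonneg hm0) _
    · exact Real.rpow_le_rpow (dtm_nonneg hm0) (dtm_le_diam hm0 hm1 hp hK hμ hz) hβ0
    · exact Real.rpow_nonneg (dtm_nonneg hm0) _
    · exact Real.rpow_le_rpow (dtm_nonneg hm0) (dtm_le_diam hm0 hm1 hp hK hν hz) hβ0
  set S := supNormOn K (fun x => dtm m p μ x ^ β - dtm m p ν x ^ β) with hS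
  have hSB : ∀ z ∈ K, |dtm m p μ z ^ β - dtm m p ν z ^ β| ≤ S.toReal := by
    intro z hz
    rw [← ENNReal.ofReal_le_iff_le_toReal hfin, ← Real.norm_eq_abs, ofReal_norm]
    exact le_iSup₂ (f := fun z _ => ‖dtm m p μ z ^ β - dtm m p ν z ^ β‖ₑ) z hz
  have hS0 : 0 ≤ S.toReal := ENNReal.toReal_nonneg
  refine iSup₂_le fun ⟨x, y⟩ ⟨hx, hy⟩ => ?_
  rw [← ENNReal.ofReal_toReal hfin, ← ENNReal.ofReal_mul
    (mul_nonneg (geodesicConst_pos hm0 hβ).le Metric.diam_nonneg), ← ofReal_norm,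
    Real.norm_eq_abs]
  refine ENNReal.ofReal_le_ofReal (abs_sub_le_iff.2 ⟨?_, ?_⟩)
  · have := fdtm_le_fdtm_add hm0 hm1 hp hβ hK hKc hF hFK hν hμ hu hx hy hS0 fun z hz => by
      linarith [(abs_sub_le_iff.1 (hSB z hz)).1]
    linarith
  · have := fdtm_le_fdtm_add hm0 hm1 hp hβ hK hKc hF hFK hμ hν hu hx hy hS0 fun z hz => by
      linarith [(abs_sub_le_iff.1 (hSB z hz)).2]
    linarith

end Geodesics

end FermatDTM

theorem mainTheorem2 {d : ℕ} (m p β : ℝ) (hm0 : 0 < m) (hm1 : m ≤ 1) (hp : 1 ≤ p) (hβ : 1 ≤ β)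
    (K : Set (EuclideanSpace ℝ (Fin d))) (hK : IsCompact K) (hKc : Convex ℝ K)
    (F : Set (EuclideanSpace ℝ (Fin d))) (hF : IsClosed F) (hFK : F ⊆ K)
    (μ ν : MeasureTheory.Measure (EuclideanSpace ℝ (Fin d)))
    [MeasureTheory.IsProbabilityMeasure μ] [MeasureTheory.IsProbabilityMeasure ν]
    (hμ : μ.support ⊆ K) (hν : ν.support ⊆ K) :
    (∀ x ∈ K, ∀ y ∈ K, ∀ γ : ℝ → EuclideanSpace ℝ (Fin d),
      FermatDTM.IsGeodesic m p β μ F x y γ →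
        FermatDTM.pathLength γ ≤ ENNReal.ofReal (FermatDTM.geodesicConst m β) *
          FermatDTM.supNormOn (γ '' Set.Icc 0 1) (FermatDTM.dtm m p μ)) ∧
    FermatDTM.supNormOn (K ×ˢ K)
        (fun z => FermatDTM.fdtm m p β μ F z.1 z.2 - FermatDTM.fdtm m p β ν F z.1 z.2) ≤
      ENNReal.ofReal (FermatDTM.geodesicConst m β * Metric.diam K) *
        FermatDTM.supNormOn K
          (fun x => FermatDTM.dtm m p μ x ^ β - FermatDTM.dtm m p ν x ^ β) ∧
    ENNReal.ofReal (FermatDTM.geodesicConst m β * Metric.diam K) *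
        FermatDTM.supNormOn K
          (fun x => FermatDTM.dtm m p μ x ^ β - FermatDTM.dtm m p ν x ^ β) ≤
      ENNReal.ofReal (β * FermatDTM.geodesicConst m β / m ^ (1 / p) * Metric.diam K ^ β) *
        FermatDTM.wasserstein p μ ν := by
  refine ⟨fun x _ y _ γ hγ => ?_, ?_, ?_⟩
  · exact hγ.pathLength_le hm0 hm1 hp hβ hF
      (FermatDTM.exists_ball_measure_eq_one hK.isBounded hμ)
  · exact FermatDTM.supNormOn_fdtm_sub_le hm0 hm1 hp hβ hK.isBounded hKc hF hFK hμ hν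
  · exact FermatDTM.ofReal_mul_supNormOn_le_wasserstein (FermatDTM.geodesicConst_pos hm0 hβ).le
      hm0 hm1 hp hβ hK.isBounded hμ hν
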